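/- Let $\mathbb{G}$ be a compact quantum group, with associated CQG algebra $\mathcal{A}=\mathrm{Pol}(\mathbb{G})$ (a Hopf $^*$-algebra over $\mathbb{C}$ linearly spanned by the coefficients of its finite-dimensional unitary representations) and coproduct $\Delta$. Let $\mathcal{A}^{\mathrm{cop}}=\mathrm{Pol}(\mathbb{G}^{\mathrm{cop}})$ be the same $^*$-algebra with the flipped coproduct, let $\widetilde{\ }:\mathcal{A}\to\mathcal{A}^{\mathrm{cop}}$ be the formal identity map, and let \[\widetilde{\Delta}=(\mathrm{id}\otimes\widetilde{\ })\circ\Delta:\mathcal{A}\to\mathcal{A}\odot\mathcal{A}^{\mathrm{cop}},\] where $\odot$ is the algebraic tensor product. The Haar state of a CQG algebra is its unique normalised, positive, left and right invariant linear functional. Call an element of a $^*$-algebra positive if it is a finite sum of elements $y^*y$, and a linear map positive if it maps positive elements to positive elements. The algebra $\widetilde{\Delta}(\mathcal{A})$ is expected, i.e. there exists a positive unital linear projection $E$ from $\mathcal{A}\odot\mathcal{A}^{\mathrm{cop}}$ onto $\widetilde{\Delta}(\mathcal{A})$ which preserves the Haar state of $\mathcal{A}\odot\mathcal{A}^{\mathrm{cop}}$,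 if and only if $\mathbb{G}$ is of Kac type, i.e. the Haar state of $\mathcal{A}$ is a trace. -/

import Mathlib

open scoped TensorProduct ComplexOrder

universe u

namespace CompactQuantumGroup

section Basic

variable (A : Type u) [Ring A] [StarRing A]

/-- The cone of positive elements of a star-algebra: finite sums of elements `star y * y`. -/
def positiveCone : AddSubmonoid A :=
  AddSubmonoid.closure (Set.range fun y : A => star y * y)

variable {A}

/-- A Haar state: a normalised positive linear functional which is left and right invariant,
`(h ⊗ id) Δ(a) = h(a) 1 = (id ⊗ h) Δ(a)`. (Such a functional is automatically unique.) -/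
structure IsHaarState [Bialgebra ℂ A] (h : A →ₗ[ℂ] ℂ) : Prop where
  map_one : h 1 = 1
  nonneg : ∀ a : A, 0 ≤ h (star a * a)
  left_invariant : ∀ a : A,
    TensorProduct.lid ℂ A (h.rTensor A (Coalgebra.comul (R := ℂ) a)) = h a • (1 : A)
  right_invariant : ∀ a : A,
    TensorProduct.rid ℂ A (h.lTensor A (Coalgebra.comul (R := ℂ) a)) = h a • (1 : A)

/-- A finite-dimensional unitary representation of the quantum group: a unitary matrix `u` over `A`
with `Δ(u i j) = ∑ k, u i k ⊗ u k j`. -/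
structure IsUnitaryRep [Bialgebra ℂ A] {n : ℕ} (u : Matrix (Fin n) (Fin n) A) : Prop where
  star_mul_self : star u * u = 1
  mul_star_self : u * star u = 1
  comul_apply : ∀ i j, Coalgebra.comul (R := ℂ) (u i j) = ∑ k, u i k ⊗ₜ[ℂ] u k j

variable (A)

/-- A CQG algebra, i.e. the algebra `Pol(𝔾)` of a compact quantum group `𝔾`: a Hopf star-algebra
which is the linear span of the coefficients of its finite-dimensional unitary representations. -/
class IsCQGAlgebra [HopfAlgebra ℂ A] [StarModule ℂ A] : Prop where
  comul_star : ∀ a : A, Coalgebra.comul (R := ℂ) (star a) = star (Coalgebra.comul (R := ℂ) a)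
  span_coeff : Submodule.span ℂ
    {a : A | ∃ (n : ℕ) (u : Matrix (Fin n) (Fin n) A), IsUnitaryRep u ∧ ∃ i j, u i j = a} = ⊤

/-- A compact quantum group is of Kac type if its Haar state is a trace. -/
def IsKacType [Bialgebra ℂ A] : Prop :=
  ∃ h : A →ₗ[ℂ] ℂ, IsHaarState h ∧ ∀ a b : A, h (a * b) = h (b * a)

variable {A}

/-- A subspace `B` is expected if there is a positive unital projection of the whole algebra onto
`B` which preserves the Haar state. -/
def IsExpected [Bialgebra ℂ A] (B : Submodule ℂ A) : Prop :=
  ∃ h : A →ₗ[ℂ] ℂ, IsHaarState h ∧ ∃ E : A →ₗ[ℂ] A,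
    (∀ x, E x ∈ B) ∧ (∀ b ∈ B, E b = b) ∧ E 1 = 1 ∧
    (∀ x ∈ positiveCone A, E x ∈ positiveCone A) ∧ ∀ x, h (E x) = h x

end Basic

/-- `Pol(𝔾^cop)`: the same star-algebra as `A = Pol(𝔾)`, with the flipped coproduct. -/
def Cop (A : Type u) : Type u := A

namespace Cop

variable (A : Type u) [Ring A]

instance instRing : Ring (Cop A) := inferInstanceAs (Ring A)

instance instStarRing [StarRing A] : StarRing (Cop A) := inferInstanceAs (StarRing A)

instance instAlgebra [Algebra ℂ A] : Algebra ℂ (Cop A) := inferInstanceAs (Algebra ℂ A)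

instance instStarModule [StarRing A] [Algebra ℂ A] [StarModule ℂ A] : StarModule ℂ (Cop A) :=
  inferInstanceAs (StarModule ℂ A)

/-- The formal identity map `a ↦ ã` from `Pol(𝔾)` to `Pol(𝔾^cop)`. -/
def tilde [Algebra ℂ A] : A ≃ₐ[ℂ] Cop A := AlgEquiv.refl

/-- The flipped coproduct `Δ^cop = Σ ∘ Δ`, with the same counit. -/
noncomputable instance instCoalgebraStruct [Bialgebra ℂ A] : CoalgebraStruct ℂ (Cop A) where
  comul := TensorProduct.map (tilde A).toLinearMap (tilde A).toLinearMap ∘ₗ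
    (TensorProduct.comm ℂ A A).toLinearMap ∘ₗ Coalgebra.comul ∘ₗ (tilde A).symm.toLinearMap
  counit := Coalgebra.counit ∘ₗ (tilde A).symm.toLinearMap


variable {A}

theorem comul_def [Bialgebra ℂ A] (a : A) : Coalgebra.comul (R := ℂ) (tilde A a) =
   TensorProduct.map (tilde A).toLinearMap (tilde A).toLinearMap
    (TensorProduct.comm ℂ A A (Coalgebra.comul (R := ℂ) a)) := rfl

theorem counit_def [Bialgebra ℂ A] (a : A) : Coalgebra.counit (R := ℂ) (tilde A a) =
   Coalgebra.counit (R := ℂ) a := rfl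

/-- The map `a ⊗ (b ⊗ c) ↦ c̃ ⊗ (b̃ ⊗ ã)`. -/
noncomputable def rev3 [Algebra ℂ A] : A ⊗[ℂ] (A ⊗[ℂ] A) →ₗ[ℂ] Cop A ⊗[ℂ] (Cop A ⊗[ℂ] Cop A) :=
  (TensorProduct.assoc ℂ (Cop A) (Cop A) (Cop A)).toLinearMap ∘ₗ
  TensorProduct.map (TensorProduct.map (tilde A).toLinearMap (tilde A).toLinearMap ∘ₗ
    (TensorProduct.comm ℂ A A).toLinearMap) (tilde A).toLinearMap ∘ₗ (TensorProduct.comm ℂ A (A ⊗[ℂ] A)).toLinearMap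

noncomputable instance instCoalgebra [Bialgebra ℂ A] : Coalgebra ℂ (Cop A) where
  coassoc := by
    ext a
    obtain ⟨a, rfl⟩ := (tilde A).surjective a
    have key := congrArg rev3 (Coalgebra.coassoc_apply (R := ℂ) a).symm
    simp only [LinearMap.comp_apply, comul_def, LinearEquiv.coe_coe]
    convert key using 1
    · generalize Coalgebra.comul (R := ℂ) a = x
      induction x with
      | zero => simp
      | add x y hx hy => simp only [map_add, hx, hy]
      | tmul b c =>
        simp [rev3, comul_def]
    · generalize Coalgebra.comul (R := ℂ) a = x
      induction x with
      | zero => simp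
      | add x y hx hy => simp only [map_add, hx, hy]
      | tmul b c =>
        simp [rev3, comul_def]
        generalize Coalgebra.comul (R := ℂ) b = x
        induction x with
        | zero => simp
        | add x y hx hy => simp only [map_add, hx, hy, TensorProduct.tmul_add, TensorProduct.add_tmul]
        | tmul b c => simp
  rTensor_counit_comp_comul := by
    ext a
    obtain ⟨a, rfl⟩ := (tilde A).surjective a
    have key := congrArg (TensorProduct.map LinearMap.id (tilde A).toLinearMap ∘ₗ (TensorProduct.comm ℂ A ℂ).toLinearMap)
      (Coalgebra.lTensor_counit_comul (R := ℂ) a)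
    rw [LinearMap.comp_apply, comul_def]
    refine Eq.trans ?_ (key.trans (by simp))
    generalize Coalgebra.comul (R := ℂ) a = x
    induction x with
    | zero => simp
    | add x y hx hy => simp only [map_add, hx, hy]
    | tmul b c => simp [counit_def]
  lTensor_counit_comp_comul := by
    ext a
    obtain ⟨a, rfl⟩ := (tilde A).surjective a
    have key := congrArg (TensorProduct.map (tilde A).toLinearMap LinearMap.id ∘ₗ (TensorProduct.comm ℂ ℂ A).toLinearMap)
      (Coalgebra.rTensor_counit_comul (R := ℂ) a)
    rw [LinearMap.comp_apply, comul_def]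
    refine Eq.trans ?_ (key.trans (by simp))
    generalize Coalgebra.comul (R := ℂ) a = x
    induction x with
    | zero => simp
    | add x y hx hy => simp only [map_add, hx, hy]
    | tmul b c => simp [counit_def]

noncomputable instance instBialgebra [Bialgebra ℂ A] : Bialgebra ℂ (Cop A) :=
  Bialgebra.mk' ℂ (Cop A)
    (by rw [← map_one (tilde A)]; exact (counit_def 1).trans Bialgebra.counit_one)
    (by
      intro a b
      obtain ⟨a, rfl⟩ := (tilde A).surjective a
      obtain ⟨b, rfl⟩ := (tilde A).surjective b
      rw [← map_mul]; exact (counit_def _).trans (Bialgebra.counit_mul a b))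
    (by
      rw [← map_one (tilde A)]
      refine (comul_def 1).trans ?_
      rw [Bialgebra.comul_one, Algebra.TensorProduct.one_def]
      simp [Algebra.TensorProduct.one_def])
    (by
      intro a b
      obtain ⟨a, rfl⟩ := (tilde A).surjective a
      obtain ⟨b, rfl⟩ := (tilde A).surjective b
      rw [← map_mul]
      refine (comul_def _).trans ?_
      rw [Bialgebra.comul_mul]
      exact map_mul ((Algebra.TensorProduct.map (tilde A).toAlgHom (tilde A).toAlgHom).comp
        (Algebra.TensorProduct.comm ℂ A A).toAlgHom) _ _)

end Cop

/-- The map `Δ̃ = (id ⊗ ~) ∘ Δ` from `Pol(𝔾)` to `Pol(𝔾) ⊙ Pol(𝔾^cop)`. -/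
noncomputable def comulTilde (A : Type u) [Ring A] [Bialgebra ℂ A] : A →ₗ[ℂ] A ⊗[ℂ] Cop A :=
  TensorProduct.map LinearMap.id (Cop.tilde A).toLinearMap ∘ₗ Coalgebra.comul

end CompactQuantumGroup

/-!
The algebra `Δ̃(A)` is the image of the coproduct `Δ : A → A ⊗ A`, and the Haar state of
`A ⊙ Aᶜᵒᵖ` is `h ⊗ h` (`IsHaarState.exists_eq_mul`). Two bilinear forms govern everything:
`t(a, b) = h(a S(b))` (`rightPairing`) and `t'(a, b) = h(S⁻¹(b) a)` (`leftPairing`). The map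
`T(a ⊗ b̃) = t(a, b₁) b₂` satisfies `(h ⊗ h)(x Δ̃(c)) = h(T(x) c)`, and with `t'` in place of `t`
one gets the adjoint for multiplication by `Δ̃(c)` on the left.

Suppose that `h` is a trace. The two forms of strong invariance give `S² = id`, so that
`Δ̃ ∘ T` is a `Δ̃(A)`-bimodule projection. As `A ⊙ Aᶜᵒᵖ` is spanned by the elements
`(a ⊗ 1) Δ̃(c)`, and `T` sends `((a ⊗ 1) Δ̃(c))* (a' ⊗ 1) Δ̃(c')` to `h(a* a') c* c'`, positivity
reduces to that of Gram matrices (`IsHaarState.expectation_mem_positiveCone`).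

Conversely let `E` be a positive unital projection onto `Δ̃(A)` preserving `h ⊗ h`. All elements
of the algebra are bounded, and the Bernstein partition of unity gives Kadison's inequality
`E(x)² ≤ E(x²)` (`kadison`). Hence the kernel of `E` is stable under Jordan multiplication by the
range, and `(h ⊗ h)(Δ̃(b) z Δ̃(c) + Δ̃(c) z Δ̃(b)) = 0` whenever `E z = 0`
(`apply_mul_mul_add_eq_zero`). This is weaker than the bimodule property of `E`, but it is enough
when applied to `z = y ⊗ 1 - h(y) 1`: summed over `y = S⁻¹(b₁) a` and `b₂`, it says that
`δ = t - t'` satisfies `δ(a, b₁) h(b₂ c) + ν(b₁) h(c b₂) = 0` for all `c`, with some functional `ν`.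
By strong invariance and faithfulness of `h`, the elements `x = δ(a, b₁) b₂` then satisfy
`x₁ ⊗ S²(x₂) = x₁ ⊗ x₂` and `S²(x) = x`. On such elements `t` and `t'` are symmetric, hence
coincide (`IsHaarState.rightPairing_eq_leftPairing`), so `δ` vanishes on `x`.
Thus, for a unitary representation `u`, the matrices `δ(a, u)` form a right ideal with zero
products, and since it contains `δ(a, u) δ(a, u)*`, they are all zero
(`IsHaarState.mul_comm_of_relation`). Finally `t = t'` says that `S²` is the modular automorphism of
`h`; the symmetries of `t` and `t'` under `S²` and `S⁻²` give `S⁴ = id`, positivity gives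
`S² = id`, and `h` is a trace (`IsHaarState.mul_comm_of_rightPairing_eq`).

Computations with iterated coproducts are done on matrix coefficients of representations, where
`Δ(u i j) = ∑ k, u i k ⊗ u k j`, and extended by linearity (`coeff_induction`).
-/

set_option linter.unusedSectionVars false

namespace CompactQuantumGroup

/-! ### Positive elements and bounded elements of a star-algebra -/

section StarAlgebra

variable {M : Type u} [Ring M] [StarRing M]

theorem star_mul_self_mem_positiveCone (y : M) : star y * y ∈ positiveCone M :=
  AddSubmonoid.subset_closure ⟨y, rfl⟩

theorem mul_self_mem_positiveCone {y : M} (hy : star y = y) : y * y ∈ positiveCone M := by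
  simpa [hy] using star_mul_self_mem_positiveCone y

theorem one_mem_positiveCone : (1 : M) ∈ positiveCone M := by
  simpa using star_mul_self_mem_positiveCone (1 : M)

theorem conj_mem_positiveCone {x : M} (hx : x ∈ positiveCone M) (c : M) :
    star c * x * c ∈ positiveCone M := by
  induction hx using AddSubmonoid.closure_induction with
  | mem x hx =>
    obtain ⟨y, rfl⟩ := hx
    simpa [mul_assoc] using star_mul_self_mem_positiveCone (y * c)
  | zero => simp
  | add x y _ _ hx hy => simpa [mul_add, add_mul] using add_mem hx hy

theorem star_eq_of_mem_positiveCone {x : M} (hx : x ∈ positiveCone M) : star x = x := by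
  induction hx using AddSubmonoid.closure_induction with
  | mem x hx => obtain ⟨y, rfl⟩ := hx; simp
  | zero => simp
  | add x y _ _ hx hy => simp [hx, hy]

/-- If `t` and `1 - t` are positive, so are the polynomials `t ^ k * (1 - t) ^ l`. -/
theorem pow_mul_pow_mem_positiveCone {t : M} (ht : t ∈ positiveCone M)
    (ht' : 1 - t ∈ positiveCone M) (k l : ℕ) : t ^ k * (1 - t) ^ l ∈ positiveCone M := by
  have hst := star_eq_of_mem_positiveCone ht
  have hc : Commute t (1 - t) := (Commute.one_right t).sub_right (Commute.refl t)
  -- both exponents reduce to `0` or `1` by conjugating with `t ^ a * (1 - t) ^ b`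
  have key : ∀ a b e f : ℕ, t ^ e * (1 - t) ^ f ∈ positiveCone M →
      t ^ (2 * a + e) * (1 - t) ^ (2 * b + f) ∈ positiveCone M := by
    intro a b e f hx
    have h1 := conj_mem_positiveCone hx (t ^ a * (1 - t) ^ b)
    rw [star_mul, star_pow, star_pow, star_sub, star_one, hst, ← (hc.pow_pow a b).eq] at h1
    have h2 := congrArg (Polynomial.aeval (R := ℤ) t)
      (show (Polynomial.X ^ (2 * a + e) * (1 - Polynomial.X) ^ (2 * b + f) : Polynomial ℤ) =
        Polynomial.X ^ a * (1 - Polynomial.X) ^ b * (Polynomial.X ^ e * (1 - Polynomial.X) ^ f) *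
          (Polynomial.X ^ a * (1 - Polynomial.X) ^ b) by ring)
    simp only [map_mul, map_pow, map_sub, map_one, Polynomial.aeval_X] at h2
    rwa [h2]
  -- `t (1 - t) = t (1 - t) t + (1 - t) t (1 - t)`
  have hprod : t * (1 - t) ∈ positiveCone M := by
    have h1 := conj_mem_positiveCone ht' t
    have h2 := conj_mem_positiveCone ht (1 - t)
    rw [star_sub, star_one, hst] at h2
    rw [hst] at h1
    convert add_mem h1 h2 using 1
    noncomm_ring
  obtain ⟨a, rfl | rfl⟩ := k.even_or_odd' <;> obtain ⟨b, rfl | rfl⟩ := l.even_or_odd'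
  · exact key a b 0 0 (by simpa using one_mem_positiveCone)
  · exact key a b 0 1 (by simpa using ht')
  · exact key a b 1 0 (by simpa using ht)
  · exact key a b 1 1 (by simpa using hprod)

variable [Algebra ℂ M] [StarModule ℂ M]

theorem smul_mem_positiveCone {r : ℝ} (hr : 0 ≤ r) {x : M} (hx : x ∈ positiveCone M) :
    (r : ℂ) • x ∈ positiveCone M := by
  have := conj_mem_positiveCone hx (((√r : ℝ) : ℂ) • (1 : M))
  simpa [smul_smul, Real.mul_self_sqrt hr] using this

/-- An element `x` is bounded if `star x * x` is dominated by a multiple of the identity. -/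
def IsBoundedElement (x : M) : Prop :=
  ∃ r : ℝ, 0 ≤ r ∧ (r : ℂ) • (1 : M) - star x * x ∈ positiveCone M

theorem IsBoundedElement.add {x y : M} (hx : IsBoundedElement x) (hy : IsBoundedElement y) :
    IsBoundedElement (x + y) := by
  obtain ⟨r, hr, hx⟩ := hx
  obtain ⟨s, hs, hy⟩ := hy
  refine ⟨2 * r + 2 * s, by positivity, ?_⟩
  have h := add_mem (add_mem (smul_mem_positiveCone (zero_le_two (α := ℝ)) hx)
    (smul_mem_positiveCone (zero_le_two (α := ℝ)) hy)) (star_mul_self_mem_positiveCone (x - y))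
  convert h using 1
  simp only [star_add, star_sub, mul_add, add_mul, mul_sub, sub_mul, Complex.ofReal_add,
    Complex.ofReal_mul, smul_sub, add_smul, mul_smul, Complex.ofReal_ofNat]
  simp only [two_smul]
  abel

theorem IsBoundedElement.mul {x y : M} (hx : IsBoundedElement x) (hy : IsBoundedElement y) :
    IsBoundedElement (x * y) := by
  obtain ⟨r, hr, hx⟩ := hx
  obtain ⟨s, hs, hy⟩ := hy
  refine ⟨r * s, by positivity, ?_⟩
  have h := add_mem (conj_mem_positiveCone hx y) (smul_mem_positiveCone hr hy)
  convert h using 1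
  simp [mul_sub, sub_mul, smul_sub, mul_smul, mul_assoc]

theorem IsBoundedElement.smul {x : M} (hx : IsBoundedElement x) (c : ℂ) :
    IsBoundedElement (c • x) := by
  have hc : IsBoundedElement (c • (1 : M)) := by
    refine ⟨Complex.normSq c, Complex.normSq_nonneg c, ?_⟩
    simp [smul_smul, Complex.normSq_eq_conj_mul_self, mul_comm c]
  simpa using hc.mul hx

theorem isBoundedElement_of_span_eq_top {s : Set M} (hs : Submodule.span ℂ s = ⊤)
    (h : ∀ x ∈ s, IsBoundedElement x) (x : M) : IsBoundedElement x := by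
  have hx : x ∈ Submodule.span ℂ s := hs ▸ Submodule.mem_top
  induction hx using Submodule.span_induction with
  | mem x hx => exact h x hx
  | zero => exact ⟨0, le_rfl, by simp⟩
  | add x y _ _ hx hy => exact hx.add hy
  | smul c x _ hx => exact hx.smul c

/-- A bounded self-adjoint element lies between two multiples of the identity. -/
theorem IsBoundedElement.exists_bounds {x : M} (hx : IsBoundedElement x) (hs : star x = x) :
    ∃ c : ℝ, 0 < c ∧ (c : ℂ) • (1 : M) + x ∈ positiveCone M ∧
      (c : ℂ) • (1 : M) - x ∈ positiveCone M := by
  obtain ⟨r, hr, hx⟩ := hx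
  rw [hs] at hx
  have h2 : (0 : ℝ) ≤ 1 / 2 := by norm_num
  refine ⟨1 / 2 * (1 + r), by positivity, ?_, ?_⟩
  · convert smul_mem_positiveCone h2 (add_mem hx
      (mul_self_mem_positiveCone (y := 1 + x) (by simp [hs]))) using 1
    simp only [mul_add, add_mul, mul_one, one_mul, Complex.ofReal_mul, Complex.ofReal_add]
    push_cast
    module
  · convert smul_mem_positiveCone h2 (add_mem hx
      (mul_self_mem_positiveCone (y := 1 - x) (by simp [hs]))) using 1
    simp only [mul_sub, sub_mul, mul_one, one_mul, Complex.ofReal_mul, Complex.ofReal_add]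
    push_cast
    module

/-! ### Kadison's inequality and positive projections -/

theorem map_star_of_positive {E : M →ₗ[ℂ] M}
    (hpos : ∀ x ∈ positiveCone M, E x ∈ positiveCone M) (x : M) : E (star x) = star (E x) := by
  have key : ∀ x : M, star x = x → star (E x) = E x := by
    intro x hx
    have h1 := star_eq_of_mem_positiveCone
      (hpos _ (mul_self_mem_positiveCone (y := 1 + x) (by simp [hx])))
    have h2 := star_eq_of_mem_positiveCone
      (hpos _ (mul_self_mem_positiveCone (y := 1 - x) (by simp [hx])))
    have h : x = (1 / 4 : ℂ) • ((1 + x) * (1 + x)) - (1 / 4 : ℂ) • ((1 - x) * (1 - x)) := by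
      simp only [mul_add, add_mul, mul_sub, sub_mul, mul_one, one_mul]
      module
    rw [h, map_sub, map_smul, map_smul, star_sub, star_smul, star_smul, h1, h2]
    simp
  have hre := key (realPart x : M) (realPart x).2
  have him := key (imaginaryPart x : M) (imaginaryPart x).2
  conv_rhs => rw [← realPart_add_I_smul_imaginaryPart x]
  conv_lhs => rw [← realPart_add_I_smul_imaginaryPart x]
  have h1 : star (realPart x : M) = realPart x := (realPart x).2
  have h2 : star (imaginaryPart x : M) = imaginaryPart x := (imaginaryPart x).2
  simp [hre, him, h1, h2]

/-- The positivity of `E` on the Bernstein partition of unity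
`C(n, k) t ^ k (1 - t) ^ (n - k)`, weighted by the squares of `k - n E(t)`. -/
theorem bernstein_mem_positiveCone {E : M →ₗ[ℂ] M} (h1 : E 1 = 1)
    (hpos : ∀ x ∈ positiveCone M, E x ∈ positiveCone M) {t : M} (ht : t ∈ positiveCone M)
    (ht' : 1 - t ∈ positiveCone M) (n : ℕ) :
    ((n * (n - 1 : ℕ) : ℕ) : ℂ) • E (t * t) + (n : ℂ) • E t
      - ((n * n : ℕ) : ℂ) • (E t * E t) ∈ positiveCone M := by
  set p : ℕ → M := fun k => Polynomial.aeval t (bernsteinPolynomial ℂ n k) with hp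
  have hpk : ∀ k, p k ∈ positiveCone M := by
    intro k
    have : p k = n.choose k • (t ^ k * (1 - t) ^ (n - k)) := by
      simp [hp, bernsteinPolynomial, mul_assoc, nsmul_eq_mul]
    rw [this]
    exact nsmul_mem (pow_mul_pow_mem_positiveCone ht ht' _ _) _
  have s0 : ∑ k ∈ Finset.range (n + 1), p k = 1 := by
    rw [hp, ← map_sum, bernsteinPolynomial.sum, map_one]
  have s1 : ∑ k ∈ Finset.range (n + 1), (k : ℂ) • p k = (n : ℂ) • t := by
    have := congrArg (Polynomial.aeval t) (bernsteinPolynomial.sum_smul ℂ n)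
    simpa [hp, Nat.cast_smul_eq_nsmul] using this
  have s2 : ∑ k ∈ Finset.range (n + 1), ((k * (k - 1 : ℕ) : ℕ) : ℂ) • p k =
      ((n * (n - 1 : ℕ) : ℕ) : ℂ) • (t * t) := by
    have := congrArg (Polynomial.aeval t) (bernsteinPolynomial.sum_mul_smul ℂ n)
    simp only [map_sum, map_nsmul, pow_two, map_mul, Polynomial.aeval_X] at this
    simpa only [hp, Nat.cast_smul_eq_nsmul] using this
  set y := E t with hy
  have hys : star y = y := star_eq_of_mem_positiveCone (hpos _ ht)
  have hmem : ∑ k ∈ Finset.range (n + 1),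
      star ((k : ℂ) • (1 : M) - (n : ℂ) • y) * E (p k) * ((k : ℂ) • (1 : M) - (n : ℂ) • y)
      ∈ positiveCone M :=
    sum_mem fun k _ => conj_mem_positiveCone (hpos _ (hpk k)) _
  have hterm : ∀ k : ℕ,
      star ((k : ℂ) • (1 : M) - (n : ℂ) • y) * E (p k) * ((k : ℂ) • (1 : M) - (n : ℂ) • y) =
        ((k * (k - 1 : ℕ) : ℕ) : ℂ) • E (p k) + (k : ℂ) • E (p k)
        - (n : ℂ) • (y * ((k : ℂ) • E (p k))) - (n : ℂ) • (((k : ℂ) • E (p k)) * y)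
        + ((n * n : ℕ) : ℂ) • (y * E (p k) * y) := by
    intro k
    have hk : ((k * (k - 1 : ℕ) : ℕ) : ℂ) = k * k - k := by
      cases k with
      | zero => simp
      | succ k => push_cast; ring
    rw [hk]
    simp only [star_sub, star_smul, star_one, hys, sub_mul, mul_sub, smul_mul_assoc,
      mul_smul_comm, one_mul, mul_one, star_natCast]
    push_cast
    module
  simp_rw [hterm] at hmem
  rw [Finset.sum_add_distrib, Finset.sum_sub_distrib, Finset.sum_sub_distrib,
    Finset.sum_add_distrib, ← Finset.smul_sum, ← Finset.smul_sum, ← Finset.smul_sum,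
    ← Finset.mul_sum, ← Finset.sum_mul, ← Finset.sum_mul, ← Finset.mul_sum] at hmem
  simp_rw [← map_smul, ← map_sum, s0, s1, s2, h1] at hmem
  convert hmem using 1
  simp only [map_smul, smul_mul_assoc, mul_smul_comm, mul_one, ← hy]
  push_cast
  module

theorem kadison_of_mem_positiveCone {E : M →ₗ[ℂ] M} (h1 : E 1 = 1)
    (hpos : ∀ x ∈ positiveCone M, E x ∈ positiveCone M) {p : M →ₗ[ℂ] ℂ}
    (hp : ∀ x ∈ positiveCone M, 0 ≤ p x) {t : M} (ht : t ∈ positiveCone M)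
    (ht' : 1 - t ∈ positiveCone M) : 0 ≤ p (E (t * t) - E t * E t) := by
  have hst := star_eq_of_mem_positiveCone ht
  have hEt := star_eq_of_mem_positiveCone (hpos _ ht)
  obtain ⟨a, ha⟩ : ∃ a : ℝ, p (E (t * t)) = a :=
    ⟨_, (Complex.eq_re_of_ofReal_le (r := 0) (by simpa using hp _ (hpos _ (mul_self_mem_positiveCone hst))))⟩
  obtain ⟨b, hb⟩ : ∃ b : ℝ, p (E t) = b :=
    ⟨_, (Complex.eq_re_of_ofReal_le (r := 0) (by simpa using hp _ (hpos _ ht)))⟩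
  obtain ⟨c, hc⟩ : ∃ c : ℝ, p (E t * E t) = c :=
    ⟨_, (Complex.eq_re_of_ofReal_le (r := 0) (by simpa using hp _ (mul_self_mem_positiveCone hEt)))⟩
  have hn : ∀ n : ℕ, c - a ≤ (b - a) / ((n : ℝ) + 1) := by
    intro n
    have h := hp _ (bernstein_mem_positiveCone h1 hpos ht ht' (n + 1))
    rw [map_sub, map_add, map_smul, map_smul, map_smul, ha, hb, hc] at h
    simp only [smul_eq_mul] at h
    norm_cast at h
    push_cast at h
    have hpos : (0 : ℝ) < n + 1 := by positivity
    rw [le_div_iff₀ hpos]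
    nlinarith
  have hlim : Filter.Tendsto (fun n : ℕ => (b - a) / ((n : ℝ) + 1)) Filter.atTop (nhds 0) :=
    tendsto_const_nhds.div_atTop
      (Filter.tendsto_atTop_add_const_right _ _ tendsto_natCast_atTop_atTop)
  have := ge_of_tendsto' hlim hn
  rw [map_sub, ha, hc]
  norm_cast
  linarith

/-- **Kadison's inequality** `E(x)² ≤ E(x²)`, tested against a positive functional, for a unital
positive map on a star-algebra of bounded elements. -/
theorem kadison {E : M →ₗ[ℂ] M} (h1 : E 1 = 1)
    (hpos : ∀ x ∈ positiveCone M, E x ∈ positiveCone M) {p : M →ₗ[ℂ] ℂ}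
    (hp : ∀ x ∈ positiveCone M, 0 ≤ p x) {x : M} (hb : IsBoundedElement x) (hx : star x = x) :
    0 ≤ p (E (x * x) - E x * E x) := by
  obtain ⟨c, hc, hc1, hc2⟩ := hb.exists_bounds hx
  have hc0 : (0 : ℝ) ≤ (2 * c)⁻¹ := by positivity
  have hcc : (c : ℂ) ≠ 0 := by exact_mod_cast hc.ne'
  set t : M := (((2 * c)⁻¹ : ℝ) : ℂ) • ((c : ℂ) • (1 : M) + x) with ht
  have h := kadison_of_mem_positiveCone h1 hpos hp (t := t) (smul_mem_positiveCone hc0 hc1) (by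
    convert smul_mem_positiveCone hc0 hc2 using 1
    rw [ht]
    push_cast
    match_scalars
    · field_simp; ring
    · field_simp)
  have hxt : x = (2 * c : ℂ) • t - (c : ℂ) • (1 : M) := by
    rw [ht]
    push_cast
    match_scalars
    · field_simp
    · field_simp; ring
  have : E (x * x) - E x * E x = ((4 * c ^ 2 : ℝ) : ℂ) • (E (t * t) - E t * E t) := by
    rw [hxt]
    simp only [mul_sub, sub_mul, smul_mul_assoc, mul_smul_comm, one_mul, mul_one, map_sub,
      map_smul, h1]
    push_cast
    module
  rw [this, map_smul, smul_eq_mul]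
  exact mul_nonneg (by exact_mod_cast (by positivity : (0:ℝ) ≤ 4 * c ^ 2)) h

theorem eq_zero_of_forall_add_mul_nonneg {a b : ℂ} (h : ∀ s : ℝ, 0 ≤ a + s * b) : b = 0 := by
  have h0 := h 0
  have h1 := h 1
  have ha : a.im = 0 := by simpa [eq_comm] using (Complex.le_def.1 h0).2
  have hb : b.im = 0 := by simpa [eq_comm, ha] using (Complex.le_def.1 h1).2
  have key : ∀ s : ℝ, 0 ≤ a.re + s * b.re := fun s => by
    simpa using (Complex.le_def.1 (h s)).1
  refine Complex.ext ?_ hb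
  by_contra hne
  have := key (-(a.re + 1) / b.re)
  rw [div_mul_cancel₀ _ hne] at this
  linarith

section Projection

variable {E : M →ₗ[ℂ] M} {H : M →ₗ[ℂ] ℂ} (h1 : E 1 = 1)
  (hpos : ∀ x ∈ positiveCone M, E x ∈ positiveCone M)
  (hmul : ∀ x y, E (E x * E y) = E x * E y)
  (hH : ∀ x ∈ positiveCone M, 0 ≤ H x) (hHE : ∀ x, H (E x) = H x)
  (hfaith : ∀ x, H (star (E x) * E x) = 0 → E x = 0) (hb : ∀ x : M, IsBoundedElement x)

include h1 hpos hmul hH hfaith hb in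
/-- The kernel of a positive projection is stable under the Jordan product with the self-adjoint
elements of the range: by Kadison's inequality for `z + s b`, the element `s E(z b + b z)` is
bounded below independently of `s`. -/
theorem map_jordan_eq_zero {z b : M} (hz : star z = z) (hEz : E z = 0) (hbs : star b = b)
    (hEb : E b = b) : E (z * b + b * z) = 0 := by
  set w := E (z * b + b * z) with hw
  have hws : star w = w := by
    rw [hw, ← map_star_of_positive hpos]
    simp [hz, hbs, add_comm]
  have hbb : E (b * b) = b * b := by simpa [hEb] using hmul b b
  have key : ∀ c : M, H (star c * w * c) = 0 := by
    intro c
    let p : M →ₗ[ℂ] ℂ := H ∘ₗ LinearMap.mulRight ℂ c ∘ₗ LinearMap.mulLeft ℂ (star c)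
    have hp : ∀ x ∈ positiveCone M, 0 ≤ p x := fun x hx => hH _ (conj_mem_positiveCone hx c)
    have hpw : H (star c * w * c) = p w := rfl
    rw [hpw]
    refine eq_zero_of_forall_add_mul_nonneg (a := p (E (z * z))) fun s => ?_
    have hst : star (z + (s : ℂ) • b) = z + (s : ℂ) • b := by simp [hz, hbs]
    have h := kadison h1 hpos hp (hb (z + (s : ℂ) • b)) hst
    have hexp : E ((z + (s : ℂ) • b) * (z + (s : ℂ) • b)) -
        E (z + (s : ℂ) • b) * E (z + (s : ℂ) • b) = E (z * z) + (s : ℂ) • w := by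
      rw [hw]
      simp only [map_add, map_smul, hEz, hEb, mul_add, add_mul, smul_mul_assoc, mul_smul_comm,
        zero_add, hbb]
      module
    rwa [hexp, map_add, map_smul, smul_eq_mul] at h
  have e1 := key (1 + w)
  have e2 := key (1 - w)
  have hww : H (w * w) = 0 := by
    simp only [star_add, star_sub, star_one, hws, mul_add, add_mul, mul_sub, sub_mul, mul_one,
      one_mul, map_add, map_sub] at e1 e2
    linear_combination (1 / 4) * e1 - (1 / 4) * e2
  exact hfaith _ (by rw [← hw, hws, hww])

include h1 hpos hmul hH hHE hfaith hb in
theorem apply_conj_eq_zero {z b : M} (hz : star z = z) (hEz : E z = 0) (hbs : star b = b)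
    (hEb : E b = b) : H (b * z * b) = 0 := by
  have hbb : E (b * b) = b * b := by simpa [hEb] using hmul b b
  have e1 := map_jordan_eq_zero h1 hpos hmul hH hfaith hb hz hEz hbs hEb
  have e2 := map_jordan_eq_zero h1 hpos hmul hH hfaith hb (z := z * b + b * z)
    (by simp [hz, hbs, add_comm]) e1 hbs hEb
  have e3 := map_jordan_eq_zero h1 hpos hmul hH hfaith hb hz hEz (b := b * b)
    (by simp [hbs]) hbb
  rw [← hHE] at *
  have : E (b * z * b) = (1 / 2 : ℂ) • (E ((z * b + b * z) * b + b * (z * b + b * z)) -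
      E (z * (b * b) + b * b * z)) := by
    rw [← map_sub, ← map_smul]
    congr 1
    simp only [mul_add, add_mul, mul_assoc]
    module
  rw [this, e2, e3]
  simp

include h1 hpos hmul hH hHE hfaith hb in
/-- The polarised form of the Jordan property of a positive projection `E` preserving a faithful
functional `H`: if `E z = 0` then `H (a z b + b z a) = 0` for all `a`, `b` in the range of `E`. -/
theorem apply_mul_mul_add_eq_zero {z a b : M} (hEz : E z = 0) (hEa : E a = a) (hEb : E b = b) :
    H (a * z * b + b * z * a) = 0 := by
  have hstar := map_star_of_positive hpos
  -- decompose the three arguments into self-adjoint parts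
  have hre : ∀ x : M, E (realPart x : M) = realPart (E x) := fun x => by
    simp [realPart_apply_coe, hstar]
  have him : ∀ x : M, E (imaginaryPart x : M) = imaginaryPart (E x) := fun x => by
    simp [imaginaryPart_apply_coe, hstar]
  have key : ∀ z a b : M, star z = z → E z = 0 → star a = a → E a = a → star b = b → E b = b →
      H (a * z * b + b * z * a) = 0 := by
    intro z a b hz hEz ha hEa hbs hEb
    have h := apply_conj_eq_zero h1 hpos hmul hH hHE hfaith hb hz hEz (b := a + b)
      (by simp [ha, hbs]) (by simp [hEa, hEb])
    have h2 := apply_conj_eq_zero h1 hpos hmul hH hHE hfaith hb hz hEz ha hEa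
    have h3 := apply_conj_eq_zero h1 hpos hmul hH hHE hfaith hb hz hEz hbs hEb
    simp only [mul_add, add_mul, map_add] at h ⊢
    linear_combination h - h2 - h3
  have sr : ∀ x : M, star (realPart x : M) = realPart x := fun x => (realPart x).2
  have si : ∀ x : M, star (imaginaryPart x : M) = imaginaryPart x := fun x => (imaginaryPart x).2
  have ezr : E (realPart z : M) = 0 := by rw [hre, hEz]; simp
  have ezi : E (imaginaryPart z : M) = 0 := by rw [him, hEz]; simp
  have ear : E (realPart a : M) = realPart a := by rw [hre, hEa]
  have eai : E (imaginaryPart a : M) = imaginaryPart a := by rw [him, hEa]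
  have ebr : E (realPart b : M) = realPart b := by rw [hre, hEb]
  have ebi : E (imaginaryPart b : M) = imaginaryPart b := by rw [him, hEb]
  rw [← realPart_add_I_smul_imaginaryPart z, ← realPart_add_I_smul_imaginaryPart a,
    ← realPart_add_I_smul_imaginaryPart b]
  have k1 := key _ _ _ (sr z) ezr (sr a) ear (sr b) ebr
  have k2 := key _ _ _ (sr z) ezr (sr a) ear (si b) ebi
  have k3 := key _ _ _ (sr z) ezr (si a) eai (sr b) ebr
  have k4 := key _ _ _ (sr z) ezr (si a) eai (si b) ebi
  have k5 := key _ _ _ (si z) ezi (sr a) ear (sr b) ebr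
  have k6 := key _ _ _ (si z) ezi (sr a) ear (si b) ebi
  have k7 := key _ _ _ (si z) ezi (si a) eai (sr b) ebr
  have k8 := key _ _ _ (si z) ezi (si a) eai (si b) ebi
  simp only [map_add, mul_add, add_mul, smul_mul_assoc, mul_smul_comm, map_smul, smul_eq_mul,
    smul_add] at *
  linear_combination k1 + Complex.I * k2 + Complex.I * k3 + Complex.I * Complex.I * k4 +
    Complex.I * k5 + Complex.I * Complex.I * k6 + Complex.I * Complex.I * k7 +
    Complex.I * Complex.I * Complex.I * k8

end Projection

end StarAlgebra

/-! ### Positive functionals -/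

section PositiveFunctional

variable {M : Type u} [Ring M] [StarRing M] [Algebra ℂ M] [StarModule ℂ M] {H : M →ₗ[ℂ] ℂ}

theorem map_star_of_nonneg (hH : ∀ a, 0 ≤ H (star a * a)) (a : M) : H (star a) = star (H a) := by
  have key : ∀ b : M, (H b + H (star b)).im = 0 := by
    intro b
    have h1 := (Complex.le_def.1 (hH (1 + b))).2
    have h2 := (Complex.le_def.1 (hH b)).2
    have h3 := (Complex.le_def.1 (hH 1)).2
    simp only [star_add, star_one, mul_add, add_mul, one_mul, mul_one, map_add, Complex.add_im,
      Complex.zero_im] at h1 h2 h3 ⊢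
    linarith
  have h1 := key a
  have h2 := key (Complex.I • a)
  simp only [star_smul, map_smul, Complex.add_im, smul_eq_mul, Complex.mul_im, Complex.I_re,
    Complex.I_im, RCLike.star_def, Complex.conj_I, Complex.neg_re, Complex.neg_im] at h1 h2
  apply Complex.ext
  · simp; linarith
  · simp; linarith

theorem apply_star_mul_eq_zero (hH : ∀ a, 0 ≤ H (star a * a)) {x : M} (hx : H (star x * x) = 0)
    (c : M) : H (star c * x) = 0 := by
  have key : ∀ c : M, (H (star c * x)).re = 0 := by
    intro c
    have hs : H (star x * c) = star (H (star c * x)) := by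
      rw [← map_star_of_nonneg hH]; simp
    by_contra hne
    have hc := (Complex.le_def.1 (hH c)).1
    simp only [Complex.zero_re] at hc
    set r := (H (star c * x)).re with hr
    set g := (H (star c * c)).re with hg
    -- the quadratic polynomial `2 s r + s² g` would be negative at this point
    have h := (Complex.le_def.1 (hH (x + ((-r / (g + 1) : ℝ) : ℂ) • c))).1
    have hexp : H (star (x + ((-r / (g + 1) : ℝ) : ℂ) • c) * (x + ((-r / (g + 1) : ℝ) : ℂ) • c)) =
        ((-r / (g + 1) : ℝ) : ℂ) * (H (star c * x) + star (H (star c * x))) +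
        (((-r / (g + 1) : ℝ) * (-r / (g + 1) : ℝ) : ℝ) : ℂ) * H (star c * c) := by
      simp only [star_add, star_smul, mul_add, add_mul, smul_mul_assoc, mul_smul_comm, map_add,
        map_smul, hx, hs, smul_eq_mul, RCLike.star_def, Complex.conj_ofReal]
      push_cast
      ring
    rw [hexp, Complex.add_re, Complex.re_ofReal_mul, Complex.re_ofReal_mul, Complex.add_re,
      RCLike.star_def, Complex.conj_re, ← hr, ← hg, Complex.zero_re] at h
    have hg1 : 0 < g + 1 := by linarith
    have h2 : -r / (g + 1) * (r + r) + -r / (g + 1) * (-r / (g + 1)) * g =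
        -(r ^ 2 * (g + 2)) / (g + 1) ^ 2 := by
      field_simp
      ring
    rw [h2] at h
    have h3 : 0 < r ^ 2 * (g + 2) / (g + 1) ^ 2 := by positivity
    rw [neg_div] at h
    linarith
  apply Complex.ext (key c)
  have h := key (Complex.I • c)
  simpa using h

end PositiveFunctional

/-! ### Matrix coefficients of representations -/

section Coefficients

variable {A : Type u} [Ring A] [StarRing A] [HopfAlgebra ℂ A] {n m : ℕ}
  {u : Matrix (Fin n) (Fin n) A} {v : Matrix (Fin m) (Fin m) A}

open HopfAlgebra Coalgebra

/-- A finite-dimensional, not necessarily unitary, representation: a matrix `u` with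
`Δ(u i j) = ∑ k, u i k ⊗ u k j` and `ε(u i j) = δ i j`. -/
structure IsRep (u : Matrix (Fin n) (Fin n) A) : Prop where
  comul_apply : ∀ i j, comul (R := ℂ) (u i j) = ∑ k, u i k ⊗ₜ[ℂ] u k j
  counit_apply : ∀ i j, counit (R := ℂ) (u i j) = if i = j then 1 else 0

theorem IsUnitaryRep.isRep (hu : IsUnitaryRep u) : IsRep u := by
  refine ⟨hu.comul_apply, fun i j => ?_⟩
  -- the scalar matrix `ε(u)` satisfies `ε(u) u = u`, and `u` is invertible
  have h : (u.map fun a => algebraMap ℂ A (counit (R := ℂ) a)) * u = u := by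
    ext i j
    have := congrArg (TensorProduct.lid ℂ A) (rTensor_counit_comul (R := ℂ) (u i j))
    rw [hu.comul_apply] at this
    simpa [Matrix.mul_apply, Algebra.smul_def] using this
  have h1 : (u.map fun a => algebraMap ℂ A (counit (R := ℂ) a)) = 1 := by
    rw [← mul_one (u.map _), ← hu.mul_star_self, ← mul_assoc, h]
  have h2 := congrArg (counit (R := ℂ)) (congrFun (congrFun h1 i) j)
  rw [Matrix.map_apply, Matrix.one_apply, Bialgebra.counit_algebraMap] at h2
  rw [h2]
  split_ifs <;> simp

namespace IsRep

theorem sum_antipode_mul (hu : IsRep u) (i j) :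
    ∑ k, antipode ℂ (u i k) * u k j = if i = j then 1 else 0 := by
  have := mul_antipode_rTensor_comul_apply (R := ℂ) (u i j)
  rw [hu.comul_apply, hu.counit_apply] at this
  simp only [map_sum, LinearMap.rTensor_tmul, LinearMap.mul'_apply] at this
  rw [this]
  split_ifs <;> simp

theorem sum_mul_antipode (hu : IsRep u) (i j) :
    ∑ k, u i k * antipode ℂ (u k j) = if i = j then 1 else 0 := by
  have := mul_antipode_lTensor_comul_apply (R := ℂ) (u i j)
  rw [hu.comul_apply, hu.counit_apply] at this
  simp only [map_sum, LinearMap.lTensor_tmul, LinearMap.mul'_apply] at this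
  rw [this]
  split_ifs <;> simp

end IsRep

theorem IsUnitaryRep.antipode_apply (hu : IsUnitaryRep u) (i j) :
    antipode ℂ (u i j) = star (u j i) := by
  have h : u.map (antipode ℂ) * u = 1 := by
    ext i j
    rw [Matrix.mul_apply, Matrix.one_apply]
    exact hu.isRep.sum_antipode_mul i j
  have h2 : u.map (antipode ℂ) = star u := by
    rw [← mul_one (u.map _), ← hu.mul_star_self, ← mul_assoc, h, one_mul]
  have := congrFun (congrFun h2 i) j
  simpa [Matrix.star_apply] using this

variable [StarModule ℂ A] [IsCQGAlgebra A]

/-- Induction on the coefficients of unitary representations. -/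
theorem coeff_induction {p : A → Prop}
    (coeff : ∀ (n : ℕ) (u : Matrix (Fin n) (Fin n) A), IsUnitaryRep u → ∀ i j, p (u i j))
    (zero : p 0) (add : ∀ a b, p a → p b → p (a + b)) (smul : ∀ (c : ℂ) a, p a → p (c • a))
    (a : A) : p a := by
  have ha : a ∈ (⊤ : Submodule ℂ A) := Submodule.mem_top
  rw [← IsCQGAlgebra.span_coeff] at ha
  induction ha using Submodule.span_induction with
  | mem x hx => obtain ⟨n, u, hu, i, j, rfl⟩ := hx; exact coeff n u hu i j
  | zero => exact zero
  | add x y _ _ hx hy => exact add x y hx hy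
  | smul c x _ hx => exact smul c x hx

/-- Linear maps which agree on the coefficients of unitary representations are equal. -/
theorem coeff_ext {V : Type*} [AddCommGroup V] [Module ℂ V] {f g : A →ₗ[ℂ] V}
    (h : ∀ (n : ℕ) (u : Matrix (Fin n) (Fin n) A), IsUnitaryRep u →
      ∀ i j, f (u i j) = g (u i j)) : f = g := by
  ext a
  induction a using coeff_induction with
  | coeff n u hu i j => exact h n u hu i j
  | zero => simp
  | add a b ha hb => simp [ha, hb]
  | smul c a ha => simp [ha]

theorem star_antipode_star_antipode (a : A) :
    star (antipode ℂ (star (antipode ℂ a))) = a := by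
  induction a using coeff_induction with
  | coeff n u hu i j => rw [hu.antipode_apply, star_star, hu.antipode_apply, star_star]
  | zero => simp
  | add a b ha hb => simp [ha, hb]
  | smul c a ha => simp [ha]

variable (A) in
/-- The inverse `a ↦ S(a*)*` of the antipode. -/
noncomputable def antipodeInv : A →ₗ[ℂ] A where
  toFun a := star (antipode ℂ (star a))
  map_add' a b := by simp
  map_smul' c a := by simp

theorem antipodeInv_apply (a : A) : antipodeInv A a = star (antipode ℂ (star a)) := rfl

@[simp] theorem antipodeInv_antipode (a : A) : antipodeInv A (antipode ℂ a) = a :=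
  star_antipode_star_antipode a

@[simp] theorem antipode_antipodeInv (a : A) : antipode ℂ (antipodeInv A a) = a := by
  have := star_antipode_star_antipode (star a)
  rw [antipodeInv_apply]
  exact star_injective this

theorem antipodeInv_mul (a b : A) :
    antipodeInv A (a * b) = antipodeInv A b * antipodeInv A a := by
  simp [antipodeInv_apply, antipode_mul_antidistrib]

theorem antipodeInv_one : antipodeInv A 1 = 1 := by
  simp [antipodeInv_apply]

theorem comul_antipode (a : A) : comul (R := ℂ) (antipode ℂ a) =
    TensorProduct.map (antipode ℂ) (antipode ℂ) (TensorProduct.comm ℂ A A (comul a)) := by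
  induction a using coeff_induction with
  | coeff n u hu i j =>
    rw [hu.antipode_apply, IsCQGAlgebra.comul_star, hu.comul_apply, hu.comul_apply]
    simp [hu.antipode_apply]
  | zero => simp
  | add a b ha hb => simp [ha, hb]
  | smul c a ha => simp [ha]

namespace IsRep

theorem comul_antipode_apply (hu : IsRep u) (i j) : comul (R := ℂ) (antipode ℂ (u i j)) =
    ∑ k, antipode ℂ (u k j) ⊗ₜ[ℂ] antipode ℂ (u i k) := by
  rw [comul_antipode, hu.comul_apply]
  simp

theorem sum_mul_antipodeInv (hu : IsRep u) (i j) :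
    ∑ k, u k j * antipodeInv A (u i k) = if i = j then 1 else 0 := by
  have := congrArg (antipodeInv A) (hu.sum_mul_antipode i j)
  simp only [map_sum, antipodeInv_mul, antipodeInv_antipode] at this
  rw [this]
  split_ifs <;> simp [antipodeInv_one]

theorem sum_antipodeInv_mul (hu : IsRep u) (i j) :
    ∑ k, antipodeInv A (u k j) * u i k = if i = j then 1 else 0 := by
  have := congrArg (antipodeInv A) (hu.sum_antipode_mul i j)
  simp only [map_sum, antipodeInv_mul, antipodeInv_antipode] at this
  rw [this]
  split_ifs <;> simp [antipodeInv_one]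

end IsRep

theorem counit_star (a : A) : counit (R := ℂ) (star a) = star (counit (R := ℂ) a) := by
  induction a using coeff_induction with
  | coeff n u hu i j =>
    rw [← hu.antipode_apply, counit_antipode, hu.isRep.counit_apply, hu.isRep.counit_apply]
    simp [eq_comm, apply_ite]
  | zero => simp
  | add a b ha hb => simp [ha, hb]
  | smul c a ha => simp [ha]

/-- The conjugate of a representation. -/
theorem IsRep.conj (hu : IsRep u) : IsRep (u.map star) where
  comul_apply i j := by
    rw [Matrix.map_apply, IsCQGAlgebra.comul_star, hu.comul_apply]
    simp
  counit_apply i j := by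
    rw [Matrix.map_apply, counit_star, hu.counit_apply]
    simp [apply_ite]

end Coefficients

/-! ### The Haar state on matrix coefficients -/

section Haar

open HopfAlgebra Coalgebra

variable {A : Type u} [Ring A] [StarRing A] [HopfAlgebra ℂ A] {n m : ℕ}
  {u : Matrix (Fin n) (Fin n) A} {v : Matrix (Fin m) (Fin m) A} {h : A →ₗ[ℂ] ℂ}

namespace IsHaarState

theorem sum_left (hh : IsHaarState h) (hu : IsRep u) (i j) :
    ∑ k, h (u i k) • u k j = h (u i j) • (1 : A) := by
  have := hh.left_invariant (u i j)
  rw [hu.comul_apply] at this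
  simpa using this

theorem sum_right (hh : IsHaarState h) (hu : IsRep u) (i j) :
    ∑ k, h (u k j) • u i k = h (u i j) • (1 : A) := by
  have := hh.right_invariant (u i j)
  rw [hu.comul_apply] at this
  simpa using this

theorem sum_mul_left (hh : IsHaarState h) (hu : IsRep u) (hv : IsRep v) (i j k l) :
    ∑ p, ∑ q, h (u i p * v k q) • (u p j * v q l) = h (u i j * v k l) • (1 : A) := by
  have := hh.left_invariant (u i j * v k l)
  rw [Bialgebra.comul_mul, hu.comul_apply, hv.comul_apply] at this
  simpa [Finset.sum_mul_sum] using this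

theorem sum_mul_right (hh : IsHaarState h) (hu : IsRep u) (hv : IsRep v) (i j k l) :
    ∑ p, ∑ q, h (u p j * v q l) • (u i p * v k q) = h (u i j * v k l) • (1 : A) := by
  have := hh.right_invariant (u i j * v k l)
  rw [Bialgebra.comul_mul, hu.comul_apply, hv.comul_apply] at this
  simpa [Finset.sum_mul_sum] using this

/-- Strong invariance, `b₁ h(a b₂) = S(a₁) h(a₂ b)`. -/
theorem strong_right (hh : IsHaarState h) (hu : IsRep u) (hv : IsRep v) (i j k l) :
    ∑ q, h (u i j * v q l) • v k q = ∑ p, h (u p j * v k l) • antipode ℂ (u i p) := by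
  have h1 : ∀ p, h (u p j * v k l) • antipode ℂ (u i p) =
      ∑ r, ∑ q, h (u r j * v q l) • (antipode ℂ (u i p) * u p r * v k q) := by
    intro p
    rw [← mul_one (antipode ℂ (u i p)), ← mul_smul_comm, ← hh.sum_mul_right hu hv p j k l]
    simp [Finset.mul_sum, mul_assoc]
  simp_rw [h1]
  rw [Finset.sum_comm]
  simp_rw [Finset.sum_comm (s := Finset.univ (α := Fin n)) (t := Finset.univ (α := Fin m)),
    ← Finset.smul_sum, ← Finset.sum_mul, hu.sum_antipode_mul]
  simp

/-- Strong invariance, `h(a b₁) S(b₂) = h(a₁ b) a₂`. -/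
theorem strong_left (hh : IsHaarState h) (hu : IsRep u) (hv : IsRep v) (i j k l) :
    ∑ q, h (u i j * v k q) • antipode ℂ (v q l) = ∑ p, h (u i p * v k l) • u p j := by
  have h1 : ∀ q, h (u i j * v k q) • antipode ℂ (v q l) =
      ∑ p, ∑ r, h (u i p * v k r) • (u p j * (v r q * antipode ℂ (v q l))) := by
    intro q
    rw [← one_mul (antipode ℂ (v q l)), ← smul_mul_assoc, ← hh.sum_mul_left hu hv i j k q]
    simp [Finset.sum_mul, mul_assoc]
  simp_rw [h1]
  rw [Finset.sum_comm]
  refine Finset.sum_congr rfl fun p _ => ?_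
  rw [Finset.sum_comm]
  simp_rw [← Finset.smul_sum, ← Finset.mul_sum, hv.sum_mul_antipode]
  simp

variable [StarModule ℂ A] [IsCQGAlgebra A]

/-- Strong invariance, `b₁ h(b₂ a) = S⁻¹(a₁) h(b a₂)`. -/
theorem strong_right' (hh : IsHaarState h) (hu : IsRep u) (hv : IsRep v) (i j k l) :
    ∑ q, h (v q l * u i j) • v k q = ∑ p, h (v k l * u p j) • antipodeInv A (u i p) := by
  have := congrArg (antipodeInv A) (hh.strong_right hv hu k l i j)
  simp only [map_sum, map_smul, antipodeInv_antipode] at this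
  exact this.symm

theorem map_star (hh : IsHaarState h) (a : A) : h (star a) = star (h a) :=
  map_star_of_nonneg hh.nonneg a

theorem map_antipode (hh : IsHaarState h) (a : A) : h (antipode ℂ a) = h a := by
  induction a using coeff_induction with
  | coeff n u hu i j =>
    -- right invariance makes the matrix `P = h(u)` equal to the self-adjoint matrix `P* P`
    have key : ∀ l j, h (u l j) = ∑ i, h (u i j) * star (h (u i l)) := by
      intro l j
      have h1 : ∀ i, h (u i j) • star (u i l) = ∑ k, h (u k j) • (star (u i l) * u i k) := by
        intro i
        rw [← mul_one (star (u i l)), ← mul_smul_comm, ← hh.sum_right hu.isRep i j]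
        simp [Finset.mul_sum]
      have h2 : ∑ i, h (u i j) • star (u i l) = h (u l j) • (1 : A) := by
        simp_rw [h1]
        rw [Finset.sum_comm]
        have h3 : ∀ k, ∑ i, star (u i l) * u i k = if l = k then 1 else 0 := fun k => by
          simpa only [hu.antipode_apply] using hu.isRep.sum_antipode_mul l k
        simp_rw [← Finset.smul_sum, h3]
        simp
      have h4 := congrArg h h2
      simpa [hh.map_one, hh.map_star] using h4.symm
    rw [hu.antipode_apply, hh.map_star, key, key i j]
    simp [mul_comm]
  | zero => simp
  | add a b ha hb => simp [ha, hb]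
  | smul c a ha => simp [ha]

theorem map_antipodeInv (hh : IsHaarState h) (a : A) : h (antipodeInv A a) = h a := by
  rw [← hh.map_antipode (antipodeInv A a), antipode_antipodeInv]

/-- The left kernel of `h` is a subcomodule: if `h(x c) = 0` for all `c`, then
`h(x₁ c) x₂ = 0` for all `c`. -/
theorem lid_rTensor_comul_eq_zero (hh : IsHaarState h) {x : A} (hx : ∀ c, h (x * c) = 0) (c : A) :
    TensorProduct.lid ℂ A ((h ∘ₗ LinearMap.mulRight ℂ c).rTensor A (comul (R := ℂ) x)) = 0 := by
  -- by strong invariance the left-hand side is `S(h(x c₁) c₂)`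
  have key : ∀ c x : A,
      TensorProduct.lid ℂ A ((h ∘ₗ LinearMap.mulRight ℂ c).rTensor A (comul (R := ℂ) x)) =
      antipode ℂ (TensorProduct.lid ℂ A
        ((h ∘ₗ LinearMap.mulLeft ℂ x).rTensor A (comul (R := ℂ) c))) := by
    intro c x
    induction c using coeff_induction with
    | coeff m v hv k l =>
      induction x using coeff_induction with
      | coeff n u hu i j =>
        rw [hu.comul_apply, hv.comul_apply]
        simpa using (hh.strong_left hu.isRep hv.isRep i j k l).symm
      | zero => simp
      | add a b ha hb =>
        have : (h ∘ₗ LinearMap.mulLeft ℂ (a + b)) =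
          h ∘ₗ LinearMap.mulLeft ℂ a + h ∘ₗ LinearMap.mulLeft ℂ b := by ext; simp [add_mul]
        simp [this, ha, hb, LinearMap.rTensor_add]
      | smul r a ha =>
        have : (h ∘ₗ LinearMap.mulLeft ℂ (r • a)) = r • (h ∘ₗ LinearMap.mulLeft ℂ a) := by
          ext; simp
        simp [this, ha, LinearMap.rTensor_smul]
    | zero => simp
    | add a b ha hb =>
      have : (h ∘ₗ LinearMap.mulRight ℂ (a + b)) =
        h ∘ₗ LinearMap.mulRight ℂ a + h ∘ₗ LinearMap.mulRight ℂ b := by ext; simp [mul_add]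
      simp [this, ha, hb, LinearMap.rTensor_add]
    | smul r a ha =>
      have : (h ∘ₗ LinearMap.mulRight ℂ (r • a)) = r • (h ∘ₗ LinearMap.mulRight ℂ a) := by
        ext; simp
      simp [this, ha, LinearMap.rTensor_smul]
  rw [key]
  have : h ∘ₗ LinearMap.mulLeft ℂ x = 0 := by ext c; simp [hx]
  simp [this]

/-- The Haar state is faithful: the elements `x` with `h(x c) = 0` for all `c` form a
subcomodule on which the counit vanishes, since `ε(x) = h(x₁ S(x₂))`. -/
theorem eq_zero_of_forall_mul (hh : IsHaarState h) {x : A} (hx : ∀ c, h (x * c) = 0) : x = 0 := by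
  classical
  let b := Module.Basis.ofVectorSpace ℂ A
  -- expand `Δ(x) = ∑ eᵢ ⊗ bᵢ` in a basis; the coefficients `eᵢ` are again annihilated
  have expand : ∀ x : A, (∀ c, h (x * c) = 0) → ∃ e : Module.Basis.ofVectorSpaceIndex ℂ A →₀ A,
      (comul (R := ℂ) x = e.sum fun i a => a ⊗ₜ[ℂ] b i) ∧ ∀ i c, h (e i * c) = 0 := by
    intro x hx
    obtain ⟨e, he⟩ := (TensorProduct.equivFinsuppOfBasisRight b).symm.surjective
      (comul (R := ℂ) x)
    have he' : comul (R := ℂ) x = e.sum fun i a => a ⊗ₜ[ℂ] b i := by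
      rw [← he, TensorProduct.equivFinsuppOfBasisRight_symm_apply]
    refine ⟨e, he', fun i c => ?_⟩
    have h0 := hh.lid_rTensor_comul_eq_zero hx c
    rw [he'] at h0
    have h1 := congrArg (fun y => b.repr y i) h0
    simp only [Finsupp.sum, map_sum, LinearMap.rTensor_tmul, TensorProduct.lid_tmul,
      LinearMap.comp_apply, LinearMap.mulRight_apply, map_smul, Module.Basis.repr_self,
      map_zero, Finsupp.coe_zero, Pi.zero_apply, Finsupp.coe_finsetSum, Finset.sum_apply,
      Finsupp.smul_apply, Finsupp.single_apply, smul_eq_mul, mul_ite, mul_one, mul_zero,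
      Finset.sum_ite_eq', Finsupp.mem_support_iff] at h1
    by_cases hi : e i = 0
    · simp [hi]
    · simpa [hi] using h1
  have hcounit : ∀ x : A, (∀ c, h (x * c) = 0) → counit (R := ℂ) x = 0 := by
    intro x hx
    obtain ⟨e, he, hei⟩ := expand x hx
    have h1 := congrArg h (mul_antipode_lTensor_comul_apply (R := ℂ) x)
    rw [he] at h1
    simp only [Finsupp.sum, map_sum, LinearMap.lTensor_tmul, LinearMap.mul'_apply, hei,
      Finset.sum_const_zero, Algebra.algebraMap_eq_smul_one, map_smul, hh.map_one, smul_eq_mul,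
      mul_one] at h1
    exact h1.symm
  obtain ⟨e, he, hei⟩ := expand x hx
  have h1 := congrArg (TensorProduct.lid ℂ A) (rTensor_counit_comul (R := ℂ) x)
  rw [he] at h1
  simp only [Finsupp.sum, map_sum, LinearMap.rTensor_tmul, TensorProduct.lid_tmul,
    fun i => hcounit (e i) (hei i), zero_smul, Finset.sum_const_zero, one_smul] at h1
  exact h1.symm

theorem eq_zero_of_star_mul_self (hh : IsHaarState h) {x : A} (hx : h (star x * x) = 0) :
    x = 0 := by
  have h1 : star x = 0 := hh.eq_zero_of_forall_mul fun c => by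
    have := apply_star_mul_eq_zero hh.nonneg hx c
    have h2 := hh.map_star (star c * x)
    rw [this] at h2
    simpa using h2
  simpa using h1

end IsHaarState

end Haar

/-! ### Balanced pairings -/

section Pairing

open HopfAlgebra Coalgebra

variable {A : Type u} [Ring A] [StarRing A] [HopfAlgebra ℂ A] {n m : ℕ}
  {u : Matrix (Fin n) (Fin n) A} {v : Matrix (Fin m) (Fin m) A} {h : A →ₗ[ℂ] ℂ}

/-- A bilinear form with `f(a, b₁) b₂ = a₁ f(a₂, b)` and `f(a₁, a₂) = ε(a)`, in terms of matrix
coefficients. -/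
structure IsBalancedPairing (f : A →ₗ[ℂ] A →ₗ[ℂ] ℂ) : Prop where
  balanced : ∀ {n m : ℕ} {u : Matrix (Fin n) (Fin n) A} {v : Matrix (Fin m) (Fin m) A},
    IsRep u → IsRep v → ∀ i j k l,
      ∑ p, f (v k l) (u i p) • u p j = ∑ q, f (v q l) (u i j) • v k q
  normalized : ∀ {n : ℕ} {u : Matrix (Fin n) (Fin n) A}, IsRep u → ∀ i j,
    ∑ p, f (u i p) (u p j) = if i = j then 1 else 0

/-- Two balanced pairings satisfy `g(a, b) = f(a₁, b₂) g(a₂, b₁)`. -/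
theorem IsBalancedPairing.apply_eq_sum {f g : A →ₗ[ℂ] A →ₗ[ℂ] ℂ} (hf : IsBalancedPairing f)
    (hg : IsBalancedPairing g) (hu : IsRep u) (hv : IsRep v) (i j k l) :
    g (v k l) (u i j) = ∑ q, ∑ r, f (v k q) (u r j) * g (v q l) (u i r) := by
  have h1 : ∀ r, ∑ p, g (v k l) (u i p) * f (u p r) (u r j) =
      ∑ q, g (v q l) (u i r) * f (v k q) (u r j) := fun r => by
    simpa using congrArg (fun x => f x (u r j)) (hg.balanced hu hv i r k l)
  calc g (v k l) (u i j) = ∑ p, g (v k l) (u i p) * ∑ r, f (u p r) (u r j) := by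
        simp [hf.normalized hu]
    _ = ∑ r, ∑ p, g (v k l) (u i p) * f (u p r) (u r j) := by
        simp_rw [Finset.mul_sum]
        exact Finset.sum_comm
    _ = ∑ q, ∑ r, f (v k q) (u r j) * g (v q l) (u i r) := by
        simp_rw [h1]
        rw [Finset.sum_comm]
        simp_rw [mul_comm]

/-- The form `h(a S(b))`. -/
noncomputable def rightPairing (h : A →ₗ[ℂ] ℂ) : A →ₗ[ℂ] A →ₗ[ℂ] ℂ :=
  ((LinearMap.mul ℂ A).compr₂ h).compl₂ (antipode ℂ)

@[simp] theorem rightPairing_apply (a b : A) : rightPairing h a b = h (a * antipode ℂ b) := rfl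

variable [StarModule ℂ A]

/-- The form `h(S⁻¹(b) a)`. -/
noncomputable def leftPairing (h : A →ₗ[ℂ] ℂ) : A →ₗ[ℂ] A →ₗ[ℂ] ℂ :=
  (((LinearMap.mul ℂ A).compr₂ h).comp (antipodeInv A)).flip

@[simp] theorem leftPairing_apply (a b : A) : leftPairing h a b = h (antipodeInv A b * a) := rfl

variable [IsCQGAlgebra A]

namespace IsHaarState

theorem rightPairing_isBalanced (hh : IsHaarState h) : IsBalancedPairing (rightPairing h) where
  balanced := by
    intro n m u v hu hv i j k l
    have hinv : ∀ p, h (v k l * antipode ℂ (u i p)) • (1 : A) =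
        ∑ q, ∑ r, h (v q l * antipode ℂ (u i r)) • (v k q * antipode ℂ (u r p)) := by
      intro p
      have := hh.right_invariant (v k l * antipode ℂ (u i p))
      rw [Bialgebra.comul_mul, hv.comul_apply, hu.comul_antipode_apply] at this
      simpa [Finset.sum_mul_sum] using this.symm
    have h1 : ∀ p, h (v k l * antipode ℂ (u i p)) • u p j =
        ∑ q, ∑ r, h (v q l * antipode ℂ (u i r)) • (v k q * (antipode ℂ (u r p) * u p j)) := by
      intro p
      rw [← one_mul (u p j), ← smul_mul_assoc, hinv]
      simp [Finset.sum_mul, mul_assoc]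
    simp_rw [rightPairing_apply, h1]
    rw [Finset.sum_comm]
    refine Finset.sum_congr rfl fun q _ => ?_
    rw [Finset.sum_comm]
    simp_rw [← Finset.smul_sum, ← Finset.mul_sum, hu.sum_antipode_mul]
    simp
  normalized := by
    intro n u hu i j
    have := congrArg h (hu.sum_mul_antipode i j)
    rw [map_sum] at this
    rw [← hh.map_one]
    simpa [apply_ite h] using this

theorem leftPairing_eq_star (hh : IsHaarState h) (a b : A) :
    leftPairing h a b = star (rightPairing h (star a) (star b)) := by
  rw [rightPairing_apply, ← hh.map_star, leftPairing_apply, antipodeInv_apply]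
  simp

theorem leftPairing_isBalanced (hh : IsHaarState h) : IsBalancedPairing (leftPairing h) where
  balanced := by
    intro n m u v hu hv i j k l
    have := congrArg star (hh.rightPairing_isBalanced.balanced hu.conj hv.conj i j k l)
    simp only [star_sum, star_smul, Matrix.map_apply, star_star] at this
    simp_rw [hh.leftPairing_eq_star]
    exact this
  normalized := by
    intro n u hu i j
    have := congrArg h (hu.sum_antipodeInv_mul i j)
    rw [map_sum] at this
    rw [← hh.map_one]
    simpa [apply_ite h] using this

theorem rightPairing_swap (hh : IsHaarState h) (a b : A) :
    rightPairing h a b = rightPairing h (antipode ℂ (antipode ℂ b)) a := by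
  rw [rightPairing_apply, ← hh.map_antipode, antipode_mul_antidistrib, rightPairing_apply]

theorem leftPairing_swap (hh : IsHaarState h) (a b : A) :
    leftPairing h a b = leftPairing h (antipodeInv A (antipodeInv A b)) a := by
  rw [leftPairing_apply, ← hh.map_antipodeInv, antipodeInv_mul, leftPairing_apply]

/-- If the linear combinations `x i j = ∑ k, D i k u k j` satisfy `h(x c) = -h(c y)` with
`y i j = ∑ k, N i k u k j`, then strong invariance on both sides gives
`h(x₁ c) S²(x₂) = h(x₁ c) x₂`, and faithfulness removes `c`. -/
theorem sum_smul_antipode_antipode (hh : IsHaarState h) (hu : IsRep u)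
    {D N : Matrix (Fin n) (Fin n) ℂ}
    (hDN : ∀ i j c, ∑ k, D i k * h (u k j * c) + ∑ k, N i k * h (c * u k j) = 0)
    (ω : A →ₗ[ℂ] ℂ) (i j) :
    ∑ l, (∑ k, D i k * ω (u k l)) • antipode ℂ (antipode ℂ (u l j)) =
      ∑ l, (∑ k, D i k * ω (u k l)) • u l j := by
  have h1 : ∀ c i j, ∑ l, (∑ k, D i k * h (u k l * c)) • antipode ℂ (antipode ℂ (u l j)) =
      ∑ l, (∑ k, D i k * h (u k l * c)) • u l j := by
    intro c i j
    induction c using coeff_induction with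
    | coeff m v hv k l =>
      have hv := hv.isRep
      have e1 : ∀ a, ∑ q, (D i a * h (u a j * v k q)) • antipode ℂ (v q l) =
          ∑ p, (D i a * h (u a p * v k l)) • u p j := fun a => by
        simp_rw [mul_smul, ← Finset.smul_sum, hh.strong_left hu hv a j k l]
      have e2 : ∀ a, ∑ q, (N i a * h (v k l * u a q)) • antipode ℂ (u q j) =
          ∑ p, (N i a * h (v k p * u a j)) • v p l := fun a => by
        simp_rw [mul_smul, ← Finset.smul_sum, hh.strong_left hv hu k l a j]
      have e1' : ∑ q, (∑ a, D i a * h (u a j * v k q)) • antipode ℂ (v q l) =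
          ∑ p, (∑ a, D i a * h (u a p * v k l)) • u p j := by
        simp_rw [Finset.sum_smul]
        rw [Finset.sum_comm, Finset.sum_congr rfl fun a _ => e1 a, Finset.sum_comm]
      have e2' : ∑ q, (∑ a, N i a * h (v k l * u a q)) • antipode ℂ (u q j) =
          ∑ p, (∑ a, N i a * h (v k p * u a j)) • v p l := by
        simp_rw [Finset.sum_smul]
        rw [Finset.sum_comm, Finset.sum_congr rfl fun a _ => e2 a, Finset.sum_comm]
      simp_rw [fun j c => eq_neg_of_add_eq_zero_right (hDN i j c), neg_smul,
        Finset.sum_neg_distrib, neg_inj] at e2'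
      have e3 := congrArg (antipode ℂ) e2'
      simp_rw [map_sum, map_smul] at e3
      rw [e3, e1']
    | zero => simp
    | add a b ha hb =>
      simp only [mul_add, map_add, Finset.sum_add_distrib, add_smul, ha, hb]
    | smul c a ha =>
      have : ∀ k l, D i k * h (u k l * c • a) = c * (D i k * h (u k l * a)) := fun k l => by
        rw [mul_smul_comm, map_smul, smul_eq_mul]; ring
      simp_rw [this, ← Finset.mul_sum, mul_smul, ← Finset.smul_sum, ha]
  -- both sides agree after applying an arbitrary functional `φ`
  rw [← sub_eq_zero, ← Module.forall_dual_apply_eq_zero_iff ℂ]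
  intro φ
  have h2 : ∑ l, φ (antipode ℂ (antipode ℂ (u l j)) - u l j) • ∑ k, D i k • u k l = 0 := by
    refine hh.eq_zero_of_forall_mul fun c => ?_
    have := congrArg φ (sub_eq_zero.2 (h1 c i j))
    simpa [Finset.sum_mul, ← Finset.sum_sub_distrib, mul_sub, sub_mul, mul_comm] using this
  have h3 := congrArg ω h2
  simpa [← Finset.sum_sub_distrib, mul_sub, sub_mul, mul_comm] using h3

/-- On combinations `x` of coefficients with `S²(x) = x` and `x₁ ⊗ S²(x₂) = x₁ ⊗ x₂` the two
pairings agree, because both are symmetric there. -/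
theorem rightPairing_eq_leftPairing (hh : IsHaarState h) (hu : IsRep u) (hv : IsRep v)
    {D : Fin n → ℂ}
    (hD : ∀ (ω : A →ₗ[ℂ] ℂ) j,
      ∑ l, (∑ k, D k * ω (u k l)) • antipode ℂ (antipode ℂ (u l j)) =
        ∑ l, (∑ k, D k * ω (u k l)) • u l j) (j k l) :
    ∑ i, D i * rightPairing h (v k l) (u i j) = ∑ i, D i * leftPairing h (v k l) (u i j) := by
  have hS : ∀ j, ∑ i, D i • antipode ℂ (antipode ℂ (u i j)) = ∑ i, D i • u i j := fun j => by
    simpa [hu.counit_apply] using hD counit j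
  have hS' : ∀ j, ∑ i, D i • antipodeInv A (antipodeInv A (u i j)) = ∑ i, D i • u i j :=
    fun j => by
      have := congrArg (fun x => antipodeInv A (antipodeInv A x)) (hS j)
      simp only [map_sum, map_smul, antipodeInv_antipode] at this
      exact this.symm
  have hD' : ∀ (ω : A →ₗ[ℂ] ℂ) j,
      ∑ l, (∑ k, D k * ω (u k l)) • antipodeInv A (antipodeInv A (u l j)) =
        ∑ l, (∑ k, D k * ω (u k l)) • u l j := fun ω j => by
    have := congrArg (fun x => antipodeInv A (antipodeInv A x)) (hD ω j)
    simp only [map_sum, map_smul, antipodeInv_antipode] at this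
    exact this.symm
  have hright : ∀ j b, ∑ i, D i * rightPairing h b (u i j) =
      ∑ i, D i * rightPairing h (u i j) b := fun j b => by
    simp_rw [hh.rightPairing_swap b]
    simpa using congrArg (fun x => rightPairing h x b) (hS j)
  have hleft : ∀ j b, ∑ i, D i * leftPairing h b (u i j) =
      ∑ i, D i * leftPairing h (u i j) b := fun j b => by
    simp_rw [hh.leftPairing_swap b]
    simpa using congrArg (fun x => leftPairing h x b) (hS' j)
  calc ∑ i, D i * rightPairing h (v k l) (u i j)
      = ∑ i, D i * ∑ q, ∑ r, leftPairing h (v k q) (u r j) * rightPairing h (v q l) (u i r) := by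
        simp_rw [fun i => hh.leftPairing_isBalanced.apply_eq_sum hh.rightPairing_isBalanced
          hu hv i j k l]
    _ = ∑ q, ∑ r, leftPairing h (v k q) (u r j) *
          ∑ i, D i * rightPairing h (v q l) (u i r) := by
        simp_rw [Finset.mul_sum]
        rw [Finset.sum_comm]
        refine Finset.sum_congr rfl fun q _ => ?_
        rw [Finset.sum_comm]
        refine Finset.sum_congr rfl fun r _ => Finset.sum_congr rfl fun i _ => by ring
    _ = ∑ q, ∑ r, (∑ i, D i * rightPairing h (u i r) (v q l)) * leftPairing h (u r j) (v k q) := by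
        refine Finset.sum_congr rfl fun q _ => ?_
        simp_rw [hright, hh.leftPairing_swap (v k q)]
        have := congrArg (fun x => leftPairing h x (v k q))
          (hD' ((rightPairing h).flip (v q l)) j)
        simp only [map_sum, map_smul, LinearMap.sum_apply, LinearMap.smul_apply, smul_eq_mul,
          LinearMap.flip_apply] at this
        rw [← this]
        exact Finset.sum_congr rfl fun r _ => mul_comm _ _
    _ = ∑ i, D i * leftPairing h (u i j) (v k l) := by
        simp_rw [fun i => hh.rightPairing_isBalanced.apply_eq_sum hh.leftPairing_isBalanced
          hv hu k l i j]
        simp_rw [Finset.mul_sum, Finset.sum_mul]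
        rw [Finset.sum_comm]
        symm
        rw [Finset.sum_comm]
        refine Finset.sum_congr rfl fun q _ => ?_
        rw [Finset.sum_comm]
        exact Finset.sum_congr rfl fun r _ => Finset.sum_congr rfl fun i _ => by ring
    _ = ∑ i, D i * leftPairing h (v k l) (u i j) := (hleft _ _).symm

/-- Traciality from the vanishing of `h(a S(b)) - h(S⁻¹(b) a)`: the square of the antipode then
implements the modular automorphism, so it is both positive and of order two. -/
theorem mul_comm_of_rightPairing_eq (hh : IsHaarState h)
    (heq : ∀ a b, rightPairing h a b = leftPairing h a b) (a b : A) : h (a * b) = h (b * a) := by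
  have hmod : ∀ a b, h (b * a) = h (a * antipode ℂ (antipode ℂ b)) := fun a b => by
    simpa using (heq a (antipode ℂ b)).symm
  have hfour : ∀ b, antipode ℂ (antipode ℂ b) = antipodeInv A (antipodeInv A b) := by
    intro b
    rw [← sub_eq_zero]
    refine hh.eq_zero_of_forall_mul fun c => ?_
    have h1 := hh.rightPairing_swap (antipodeInv A c) b
    rw [heq, hh.leftPairing_swap, ← heq] at h1
    simp only [rightPairing_apply, antipode_antipodeInv] at h1
    rw [sub_mul, map_sub, h1, sub_self]
  have hS : ∀ b : A, antipode ℂ (antipode ℂ b) = b := by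
    intro b
    rw [← sub_eq_zero]
    set y := antipode ℂ (antipode ℂ b) - b with hy
    have hSy : antipode ℂ (antipode ℂ y) = -y := by
      rw [hy, map_sub, map_sub, hfour (antipode ℂ (antipode ℂ b))]
      simp
    have h1 := hmod (star y) y
    rw [hSy, mul_neg, map_neg] at h1
    have h2 := hh.nonneg (star y)
    rw [star_star, h1] at h2
    exact hh.eq_zero_of_star_mul_self (le_antisymm (neg_nonneg.1 h2) (hh.nonneg y))
  rw [hmod b a, hS]

/-- If the difference `δ` of the two pairings satisfies
`δ(a, b₁) h(b₂ c) + ν(b₁) h(c b₂) = 0`, where only a matrix `N` in the role of `ν(u)` is needed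
on each unitary representation `u`, then `h` is a trace. On each representation the matrices `δ(a, u)` form a right ideal of square zero containing
`δ(a, u) δ(a, u)*`, so they vanish. -/
theorem mul_comm_of_relation (hh : IsHaarState h)
    (hrel : ∀ (a : A) {n : ℕ} {u : Matrix (Fin n) (Fin n) A}, IsUnitaryRep u →
      ∃ N : Matrix (Fin n) (Fin n) ℂ, ∀ i j c,
        ∑ k, (rightPairing h a (u i k) - leftPairing h a (u i k)) * h (u k j * c) +
          ∑ k, N i k * h (c * u k j) = 0) (a b : A) : h (a * b) = h (b * a) := by
  set δ : A →ₗ[ℂ] A →ₗ[ℂ] ℂ := rightPairing h - leftPairing h with hδ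
  have hδ' : ∀ a b, rightPairing h a b - leftPairing h a b = δ a b := fun a b => rfl
  simp_rw [hδ'] at hrel
  have hprod : ∀ (a a' : A) {n : ℕ} {u : Matrix (Fin n) (Fin n) A}, IsUnitaryRep u →
      ∀ i j, ∑ k, δ a (u i k) * δ a' (u k j) = 0 := by
    intro a a' n u hu i j
    obtain ⟨N, hN⟩ := hrel a hu
    induction a' using coeff_induction with
    | coeff m v hv k l =>
      have h1 := hh.rightPairing_eq_leftPairing hu.isRep hv.isRep (D := fun k => δ a (u i k))
        (fun ω j => hh.sum_smul_antipode_antipode hu.isRep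
          (D := Matrix.of fun i k => δ a (u i k)) hN ω i j) j k l
      simp_rw [← hδ', mul_sub]
      rw [Finset.sum_sub_distrib, sub_eq_zero]
      exact h1
    | zero => simp
    | add a b ha hb => simp [mul_add, Finset.sum_add_distrib, ha, hb]
    | smul c a ha => simp [mul_left_comm _ c, ← Finset.mul_sum, ha]
  have hmove : ∀ (ω : A →ₗ[ℂ] ℂ) (a : A) {n : ℕ} {u : Matrix (Fin n) (Fin n) A},
      IsUnitaryRep u → ∀ i j, ∑ k, δ a (u i k) * ω (u k j) =
        δ (TensorProduct.lid ℂ A (ω.rTensor A (comul (R := ℂ) a))) (u i j) := by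
    intro ω a n u hu i j
    induction a using coeff_induction with
    | coeff m v hv k l =>
      have h1 := congrArg ω (hh.rightPairing_isBalanced.balanced hu.isRep hv.isRep i j k l)
      have h2 := congrArg ω (hh.leftPairing_isBalanced.balanced hu.isRep hv.isRep i j k l)
      simp only [map_sum, map_smul, smul_eq_mul] at h1 h2
      rw [hv.comul_apply]
      simp only [← hδ', sub_mul, Finset.sum_sub_distrib, h1, h2, map_sum, LinearMap.rTensor_tmul,
        TensorProduct.lid_tmul, map_smul, LinearMap.sum_apply, LinearMap.smul_apply, smul_eq_mul,
        mul_comm (ω _)]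
    | zero => simp
    | add a b ha hb => simp [add_mul, Finset.sum_add_distrib, ha, hb]
    | smul c a ha => simp [mul_assoc, ← Finset.mul_sum, ha]
  have hzero : ∀ (a : A) {n : ℕ} {u : Matrix (Fin n) (Fin n) A}, IsUnitaryRep u →
      ∀ i j, δ a (u i j) = 0 := by
    intro a n u hu i j
    set D : Matrix (Fin n) (Fin n) ℂ := Matrix.of fun i j => δ a (u i j) with hD
    -- the functional `ω(b) = conj δ(a, S(b)*)` represents the adjoint matrix `D*`
    let ω : A →ₗ[ℂ] ℂ :=
      { toFun := fun b => star (δ a (star (antipode ℂ b)))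
        map_add' := fun b c => by simp
        map_smul' := fun r b => by simp }
    have hω : ∀ i j, D.conjTranspose i j = ω (u i j) := fun i j => by
      change star (δ a (u j i)) = star (δ a (star (antipode ℂ (u i j))))
      rw [hu.antipode_apply, star_star]
    have h1 : D * D.conjTranspose * D = 0 := by
      ext i j
      rw [Matrix.mul_apply, Matrix.zero_apply, ← hprod _ a hu i j]
      refine Finset.sum_congr rfl fun k _ => ?_
      rw [Matrix.mul_apply, ← hmove ω a hu i k]
      simp_rw [hω]
      rfl
    have h2 : D.conjTranspose * D = 0 := by
      rw [← Matrix.conjTranspose_mul_self_eq_zero, Matrix.conjTranspose_mul,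
        Matrix.conjTranspose_conjTranspose, mul_assoc, ← mul_assoc D, h1, mul_zero]
    exact congrFun (congrFun (Matrix.conjTranspose_mul_self_eq_zero.1 h2) i) j
  refine hh.mul_comm_of_rightPairing_eq (fun a b => ?_) a b
  rw [← sub_eq_zero, hδ']
  induction b using coeff_induction with
  | coeff n u hu i j => exact hzero a hu i j
  | zero => simp
  | add b c hb hc => simp [hb, hc]
  | smul r b hb => simp [hb]

end IsHaarState

end Pairing

/-! ### The algebra `Pol(𝔾) ⊙ Pol(𝔾^cop)` -/

section Tensor

open HopfAlgebra Coalgebra Cop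

variable {A : Type u} [Ring A] [StarRing A] [HopfAlgebra ℂ A] {n m : ℕ}
  {u : Matrix (Fin n) (Fin n) A} {v : Matrix (Fin m) (Fin m) A} {h : A →ₗ[ℂ] ℂ}
  {H : A ⊗[ℂ] Cop A →ₗ[ℂ] ℂ}

variable (A) in
/-- `Δ̃` as a homomorphism of algebras. -/
noncomputable def comulTildeHom : A →ₐ[ℂ] A ⊗[ℂ] Cop A :=
  (Algebra.TensorProduct.map (AlgHom.id ℂ A) (tilde A : A →ₐ[ℂ] Cop A)).comp
    (Bialgebra.comulAlgHom ℂ A)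

theorem comulTilde_eq (a : A) : comulTilde A a = comulTildeHom A a := rfl

theorem comulTilde_mul (a b : A) : comulTilde A (a * b) = comulTilde A a * comulTilde A b := by
  simp only [comulTilde_eq, map_mul]

theorem comulTilde_one : comulTilde A 1 = 1 := by
  simp only [comulTilde_eq, map_one]

theorem IsRep.comulTilde_apply (hu : IsRep u) (i j) :
    comulTilde A (u i j) = ∑ k, u i k ⊗ₜ[ℂ] tilde A (u k j) := by
  simp [comulTilde, hu.comul_apply]

theorem IsRep.comul_tmul_tilde (hu : IsRep u) (hv : IsRep v) (i j k l) :
    comul (R := ℂ) (u i j ⊗ₜ[ℂ] tilde A (v k l)) = ∑ p, ∑ q,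
      (u i p ⊗ₜ[ℂ] tilde A (v q l)) ⊗ₜ[ℂ] (u p j ⊗ₜ[ℂ] tilde A (v k q)) := by
  rw [TensorProduct.comul_tmul, hu.comul_apply, comul_def, hv.comul_apply]
  simp [TensorProduct.sum_tmul, TensorProduct.tmul_sum]
  rw [Finset.sum_comm]

variable [StarModule ℂ A]

theorem star_tilde (a : A) : star (tilde A a) = tilde A (star a) := rfl

theorem tmul_one_mem_positiveCone {a : A} (ha : a ∈ positiveCone A) :
    a ⊗ₜ[ℂ] (1 : Cop A) ∈ positiveCone (A ⊗[ℂ] Cop A) := by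
  induction ha using AddSubmonoid.closure_induction with
  | mem x hx =>
    obtain ⟨y, rfl⟩ := hx
    simpa using star_mul_self_mem_positiveCone (y ⊗ₜ[ℂ] (1 : Cop A))
  | zero => simp
  | add x y _ _ hx hy => simpa [TensorProduct.add_tmul] using add_mem hx hy

theorem one_tmul_mem_positiveCone {a : A} (ha : a ∈ positiveCone A) :
    (1 : A) ⊗ₜ[ℂ] tilde A a ∈ positiveCone (A ⊗[ℂ] Cop A) := by
  induction ha using AddSubmonoid.closure_induction with
  | mem x hx =>
    obtain ⟨y, rfl⟩ := hx
    simpa [star_tilde] using star_mul_self_mem_positiveCone ((1 : A) ⊗ₜ[ℂ] tilde A y)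
  | zero => simp
  | add x y _ _ hx hy => simpa [TensorProduct.tmul_add] using add_mem hx hy

variable [IsCQGAlgebra A]

theorem comulTilde_star (a : A) : comulTilde A (star a) = star (comulTilde A a) := by
  rw [comulTilde, LinearMap.comp_apply, LinearMap.comp_apply, IsCQGAlgebra.comul_star]
  generalize comul (R := ℂ) a = x
  induction x with
  | zero => simp
  | add x y hx hy => simp only [star_add, map_add, hx, hy]
  | tmul b c => simp [star_tilde]

/-- All elements of a CQG algebra are bounded, since `∑ k, (u k j)* u k j = 1`. -/
theorem isBoundedElement (a : A) : IsBoundedElement a := by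
  refine isBoundedElement_of_span_eq_top (IsCQGAlgebra.span_coeff (A := A)) ?_ a
  rintro _ ⟨n, u, hu, i, j, rfl⟩
  refine ⟨1, zero_le_one, ?_⟩
  have h1 := hu.isRep.sum_antipode_mul j j
  simp only [hu.antipode_apply, if_true] at h1
  rw [Complex.ofReal_one, one_smul, ← h1, ← Finset.sum_erase_eq_sub (Finset.mem_univ i)]
  exact sum_mem fun k _ => star_mul_self_mem_positiveCone _

theorem isBoundedElement_tensor (x : A ⊗[ℂ] Cop A) : IsBoundedElement x := by
  refine isBoundedElement_of_span_eq_top (TensorProduct.span_tmul_eq_top ℂ A (Cop A)) ?_ x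
  rintro _ ⟨a, b, rfl⟩
  obtain ⟨b, rfl⟩ := (tilde A).surjective b
  obtain ⟨r, hr, ha⟩ := isBoundedElement a
  obtain ⟨s, hs, hb⟩ := isBoundedElement b
  have h1 : IsBoundedElement (a ⊗ₜ[ℂ] (1 : Cop A)) := by
    refine ⟨r, hr, ?_⟩
    convert tmul_one_mem_positiveCone ha using 1
    simp [TensorProduct.sub_tmul, TensorProduct.smul_tmul', Algebra.TensorProduct.one_def]
  have h2 : IsBoundedElement ((1 : A) ⊗ₜ[ℂ] tilde A b) := by
    refine ⟨s, hs, ?_⟩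
    convert one_tmul_mem_positiveCone hb using 1
    simp [-Complex.coe_smul, TensorProduct.tmul_sub, Algebra.TensorProduct.one_def, star_tilde]
  simpa using h1.mul h2

namespace IsHaarState

theorem eq (hh : IsHaarState h) {h' : A →ₗ[ℂ] ℂ} (hh' : IsHaarState h') : h = h' := by
  refine coeff_ext fun n u hu i j => ?_
  have e1 := congrArg h' (hh.sum_left hu.isRep i j)
  have e2 := congrArg h (hh'.sum_right hu.isRep i j)
  simp only [map_sum, map_smul, smul_eq_mul, hh.map_one, hh'.map_one, mul_one] at e1 e2
  rw [← e1, ← e2]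
  simp_rw [mul_comm]

/-- The Haar state of `Pol(𝔾) ⊙ Pol(𝔾^cop)` is the tensor square of the Haar state of
`Pol(𝔾)`. -/
theorem exists_eq_mul (hH : IsHaarState H) :
    ∃ h : A →ₗ[ℂ] ℂ, IsHaarState h ∧ ∀ a b, H (a ⊗ₜ[ℂ] tilde A b) = h a * h b := by
  let one : Matrix (Fin 1) (Fin 1) A := 1
  have hone : IsRep one := by
    refine ⟨fun i j => ?_, fun i j => ?_⟩ <;> rw [Subsingleton.elim i 0, Subsingleton.elim j 0] <;>
      simp [one, Algebra.TensorProduct.one_def]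
  have hleft : ∀ {n m : ℕ} {u : Matrix (Fin n) (Fin n) A} {v : Matrix (Fin m) (Fin m) A},
      IsRep u → IsRep v → ∀ i j k l,
      ∑ p, ∑ q, H (u i p ⊗ₜ[ℂ] tilde A (v q l)) • (u p j ⊗ₜ[ℂ] tilde A (v k q)) =
        H (u i j ⊗ₜ[ℂ] tilde A (v k l)) • 1 := @fun n m u v hu hv i j k l => by
    have := hH.left_invariant (u i j ⊗ₜ[ℂ] tilde A (v k l))
    rw [hu.comul_tmul_tilde hv] at this
    simpa using this
  have hright : ∀ {n m : ℕ} {u : Matrix (Fin n) (Fin n) A} {v : Matrix (Fin m) (Fin m) A},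
      IsRep u → IsRep v → ∀ i j k l,
      ∑ p, ∑ q, H (u p j ⊗ₜ[ℂ] tilde A (v k q)) • (u i p ⊗ₜ[ℂ] tilde A (v q l)) =
        H (u i j ⊗ₜ[ℂ] tilde A (v k l)) • 1 := @fun n m u v hu hv i j k l => by
    have := hH.right_invariant (u i j ⊗ₜ[ℂ] tilde A (v k l))
    rw [hu.comul_tmul_tilde hv] at this
    simpa using this
  let h : A →ₗ[ℂ] ℂ := H ∘ₗ (TensorProduct.mk ℂ A (Cop A)).flip 1
  let h' : A →ₗ[ℂ] ℂ := H ∘ₗ TensorProduct.mk ℂ A (Cop A) 1 ∘ₗ (tilde A).toLinearMap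
  -- the two slice maps `a ⊗ b̃ ↦ ε(b) a` and `a ⊗ b̃ ↦ ε(a) b`
  let s : A ⊗[ℂ] Cop A →ₗ[ℂ] A := (TensorProduct.rid ℂ A).toLinearMap ∘ₗ
    LinearMap.lTensor A (counit ∘ₗ (tilde A).symm.toLinearMap)
  let s' : A ⊗[ℂ] Cop A →ₗ[ℂ] A := (TensorProduct.lid ℂ A).toLinearMap ∘ₗ
    TensorProduct.map counit (tilde A).symm.toLinearMap
  have hs : ∀ a b, s (a ⊗ₜ tilde A b) = counit (R := ℂ) b • a := fun a b => by simp [s]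
  have hs' : ∀ a b, s' (a ⊗ₜ tilde A b) = counit (R := ℂ) a • b := fun a b => by simp [s']
  have hs1 : s 1 = 1 := by
    rw [Algebra.TensorProduct.one_def, ← _root_.map_one (tilde A), hs]; simp
  have hs1' : s' 1 = 1 := by
    rw [Algebra.TensorProduct.one_def, ← _root_.map_one (tilde A), hs']; simp
  have ha : ∀ a, h a = H (a ⊗ₜ (1 : Cop A)) := fun a => rfl
  have hb : ∀ b, h' b = H (1 ⊗ₜ tilde A b) := fun b => rfl
  have hh : IsHaarState h := by
    refine ⟨by simpa [h, Algebra.TensorProduct.one_def] using hH.map_one, fun a => ?_,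
      fun a => ?_, fun a => ?_⟩
    · simpa [h] using hH.nonneg (a ⊗ₜ[ℂ] (1 : Cop A))
    · induction a using coeff_induction with
      | coeff n u hu i j =>
        have := congrArg s (hleft hu.isRep hone i j 0 0)
        simp only [map_sum, map_smul, hs, hs1] at this
        rw [hu.comul_apply]
        simpa [one, ← ha] using this
      | zero => simp
      | add a b ha hb => simp [add_smul, ha, hb]
      | smul r a ha => simp [mul_smul, ha]
    · induction a using coeff_induction with
      | coeff n u hu i j =>
        have := congrArg s (hright hu.isRep hone i j 0 0)
        simp only [map_sum, map_smul, hs, hs1] at this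
        rw [hu.comul_apply]
        simpa [one, ← ha] using this
      | zero => simp
      | add a b ha hb => simp [add_smul, ha, hb]
      | smul r a ha => simp [mul_smul, ha]
  have hh' : IsHaarState h' := by
    refine ⟨by simpa [h', Algebra.TensorProduct.one_def] using hH.map_one, fun a => ?_,
      fun a => ?_, fun a => ?_⟩
    · simpa [h', star_tilde] using hH.nonneg ((1 : A) ⊗ₜ[ℂ] tilde A a)
    · induction a using coeff_induction with
      | coeff n u hu i j =>
        have := congrArg s' (hright hone hu.isRep 0 0 i j)
        simp only [map_sum, map_smul, hs', hs1'] at this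
        rw [hu.comul_apply]
        simpa [one, ← hb] using this
      | zero => simp
      | add a b ha hb => simp [add_smul, ha, hb]
      | smul r a ha => simp [mul_smul, ha]
    · induction a using coeff_induction with
      | coeff n u hu i j =>
        have := congrArg s' (hleft hone hu.isRep 0 0 i j)
        simp only [map_sum, map_smul, hs', hs1'] at this
        rw [hu.comul_apply]
        simpa [one, ← hb] using this
      | zero => simp
      | add a b ha hb => simp [add_smul, ha, hb]
      | smul r a ha => simp [mul_smul, ha]
  have heq : h' = h := hh'.eq hh
  refine ⟨h, hh, fun a b => ?_⟩
  induction a using coeff_induction with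
  | coeff n u hu i j =>
    induction b using coeff_induction with
    | coeff m v hv k l =>
      have h1 := congrArg ((TensorProduct.lid ℂ ℂ).toLinearMap ∘ₗ
        TensorProduct.map h (h ∘ₗ (tilde A).symm.toLinearMap)) (hleft hu.isRep hv.isRep i j k l)
      have h2 : (∑ p, h (u p j) • u i p) ⊗ₜ[ℂ] tilde A (∑ q, h (v k q) • v q l) =
          ∑ p, ∑ q, (h (u p j) * h (v k q)) • (u i p ⊗ₜ[ℂ] tilde A (v q l)) := by
        simp [TensorProduct.sum_tmul, TensorProduct.tmul_sum, TensorProduct.smul_tmul',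
          mul_smul, Finset.smul_sum]
        rw [Finset.sum_comm]
        exact Finset.sum_congr rfl fun p _ => Finset.sum_congr rfl fun q _ => by rw [smul_comm]
      rw [hh.sum_right hu.isRep, hh.sum_left hv.isRep] at h2
      have h3 := congrArg H h2
      simp only [_root_.map_one, map_smul, ← TensorProduct.smul_tmul', TensorProduct.tmul_smul,
        ← Algebra.TensorProduct.one_def, hH.map_one, map_sum, smul_eq_mul, mul_one] at h3
      simp only [Algebra.TensorProduct.one_def, map_sum, map_smul, LinearMap.comp_apply,
        TensorProduct.map_tmul, AlgEquiv.toLinearMap_apply, AlgEquiv.symm_apply_apply,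
        LinearEquiv.coe_coe, TensorProduct.lid_tmul, _root_.map_one, hh.map_one, smul_eq_mul,
        mul_one] at h1
      rw [← h1, mul_comm (h (u i j)), h3]
      exact Finset.sum_congr rfl fun p _ => Finset.sum_congr rfl fun q _ => mul_comm _ _
    | zero => simp
    | add a b ha hb => simp [TensorProduct.tmul_add, mul_add, ha, hb]
    | smul r a ha => simp [ha, mul_left_comm]
  | zero => simp
  | add a b ha hb => simp [TensorProduct.add_tmul, add_mul, ha, hb]
  | smul r a ha => simp [← TensorProduct.smul_tmul', ha, mul_assoc]

end IsHaarState

end Tensor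

/-! ### Expected implies Kac type -/

section Expected

open HopfAlgebra Coalgebra Cop

variable {A : Type u} [Ring A] [StarRing A] [HopfAlgebra ℂ A] [StarModule ℂ A] [IsCQGAlgebra A]
  {n m : ℕ} {u : Matrix (Fin n) (Fin n) A} {v : Matrix (Fin m) (Fin m) A} {h : A →ₗ[ℂ] ℂ}
  {H : A ⊗[ℂ] Cop A →ₗ[ℂ] ℂ}

namespace IsHaarState

/-- The adjoint relation `(h ⊗ h)((a ⊗ b̃) Δ̃(c)) = h(a S(b₁)) h(b₂ c)`. -/
theorem apply_tmul_mul_comulTilde (hh : IsHaarState h)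
    (hH : ∀ a b, H (a ⊗ₜ[ℂ] tilde A b) = h a * h b) (hu : IsRep u) (a c : A) (i j) :
    H ((a ⊗ₜ[ℂ] tilde A (u i j)) * comulTilde A c) =
      ∑ k, h (a * antipode ℂ (u i k)) * h (u k j * c) := by
  induction c using coeff_induction with
  | coeff m v hv k l =>
    have := congrArg (fun x => h (a * x)) (hh.strong_right hu hv.isRep i j k l)
    simp only [Finset.mul_sum, mul_smul_comm, map_sum, map_smul, smul_eq_mul] at this
    rw [hv.isRep.comulTilde_apply]
    simp only [Finset.mul_sum, Algebra.TensorProduct.tmul_mul_tmul, ← map_mul, map_sum, hH]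
    simpa only [mul_comm] using this
  | zero => simp
  | add a b ha hb => simp only [map_add, mul_add, ha, hb, Finset.sum_add_distrib]
  | smul r a ha =>
    simp only [map_smul, mul_smul_comm, ha, smul_eq_mul, Finset.mul_sum, mul_left_comm]

/-- The adjoint relation `(h ⊗ h)(Δ̃(c) (a ⊗ b̃)) = h(S⁻¹(b₁) a) h(c b₂)`. -/
theorem apply_comulTilde_mul_tmul (hh : IsHaarState h)
    (hH : ∀ a b, H (a ⊗ₜ[ℂ] tilde A b) = h a * h b) (hu : IsRep u) (a c : A) (i j) :
    H (comulTilde A c * (a ⊗ₜ[ℂ] tilde A (u i j))) =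
      ∑ k, h (antipodeInv A (u i k) * a) * h (c * u k j) := by
  induction c using coeff_induction with
  | coeff m v hv k l =>
    have := congrArg (fun x => h (x * a)) (hh.strong_right' hu hv.isRep i j k l)
    simp only [Finset.sum_mul, smul_mul_assoc, map_sum, map_smul, smul_eq_mul] at this
    rw [hv.isRep.comulTilde_apply]
    simp only [Finset.sum_mul, Algebra.TensorProduct.tmul_mul_tmul, ← map_mul, map_sum, hH]
    simpa only [mul_comm (h (v k _ * a)), mul_comm (h (antipodeInv A _ * a))] using this
  | zero => simp
  | add a b ha hb => simp only [map_add, add_mul, mul_add, ha, hb, Finset.sum_add_distrib]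
  | smul r a ha =>
    simp only [map_smul, smul_mul_assoc, ha, smul_eq_mul, Finset.mul_sum, mul_left_comm]

theorem apply_tmul_one_mul_comulTilde (hh : IsHaarState h)
    (hH : ∀ a b, H (a ⊗ₜ[ℂ] tilde A b) = h a * h b) (a c : A) :
    H ((a ⊗ₜ[ℂ] 1) * comulTilde A c) = h a * h c := by
  induction c using coeff_induction with
  | coeff m v hv k l =>
    have := congrArg (fun x => h (a * x)) (hh.sum_right hv.isRep k l)
    simp only [Finset.mul_sum, mul_smul_comm, map_sum, map_smul, smul_eq_mul, mul_one] at this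
    rw [hv.isRep.comulTilde_apply]
    simp only [Finset.mul_sum, Algebra.TensorProduct.tmul_mul_tmul, one_mul, map_sum, hH]
    simpa only [mul_comm] using this
  | zero => simp
  | add a b ha hb => simp only [map_add, mul_add, ha, hb]
  | smul r a ha =>
    simp only [map_smul, mul_smul_comm, ha, smul_eq_mul, mul_left_comm]

theorem apply_comulTilde_mul_tmul_one (hh : IsHaarState h)
    (hH : ∀ a b, H (a ⊗ₜ[ℂ] tilde A b) = h a * h b) (a c : A) :
    H (comulTilde A c * (a ⊗ₜ[ℂ] 1)) = h a * h c := by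
  induction c using coeff_induction with
  | coeff m v hv k l =>
    have := congrArg (fun x => h (x * a)) (hh.sum_right hv.isRep k l)
    simp only [Finset.sum_mul, smul_mul_assoc, map_sum, map_smul, smul_eq_mul, one_mul] at this
    rw [hv.isRep.comulTilde_apply]
    simp only [Finset.sum_mul, Algebra.TensorProduct.tmul_mul_tmul, mul_one, map_sum, hH]
    simpa only [mul_comm] using this
  | zero => simp
  | add a b ha hb => simp only [map_add, add_mul, mul_add, ha, hb]
  | smul r a ha =>
    simp only [map_smul, smul_mul_assoc, ha, smul_eq_mul, mul_left_comm]

end IsHaarState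

/-- The identity `Δ̃(b₂) (S⁻¹(b₁) a ⊗ 1) = a ⊗ b̃`. -/
theorem IsRep.sum_comulTilde_mul (hu : IsRep u) (a : A) (i j) :
    ∑ k, comulTilde A (u k j) * ((antipodeInv A (u i k) * a) ⊗ₜ[ℂ] 1) =
      a ⊗ₜ[ℂ] tilde A (u i j) := by
  simp_rw [hu.comulTilde_apply, Finset.sum_mul, Algebra.TensorProduct.tmul_mul_tmul, mul_one,
    ← mul_assoc]
  rw [Finset.sum_comm]
  simp_rw [← TensorProduct.sum_tmul, ← Finset.sum_mul, hu.sum_mul_antipodeInv]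
  simp [ite_mul, TensorProduct.ite_tmul]

theorem isKacType_of_isExpected (hE : IsExpected (LinearMap.range (comulTilde A))) :
    IsKacType A := by
  obtain ⟨H, hH, E, hEmem, hEid, hE1, hEpos, hHE⟩ := hE
  obtain ⟨h, hh, hHh⟩ := hH.exists_eq_mul
  refine ⟨h, hh, hh.mul_comm_of_relation fun a n u hu => ?_⟩
  have hEΔ : ∀ c, E (comulTilde A c) = comulTilde A c := fun c => hEid _ ⟨c, rfl⟩
  have hHΔ : ∀ c, H (comulTilde A c) = h c := fun c => by
    have := hh.apply_tmul_one_mul_comulTilde hHh 1 c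
    rwa [← Algebra.TensorProduct.one_def, one_mul, hh.map_one, one_mul] at this
  have hmul : ∀ x y, E (E x * E y) = E x * E y := by
    intro x y
    obtain ⟨c, hc⟩ := hEmem x
    obtain ⟨d, hd⟩ := hEmem y
    rw [← hc, ← hd, ← comulTilde_mul, hEΔ]
  have hfaith : ∀ x, H (star (E x) * E x) = 0 → E x = 0 := by
    intro x hx
    obtain ⟨c, hc⟩ := hEmem x
    rw [← hc, ← comulTilde_star, ← comulTilde_mul, hHΔ] at hx
    rw [← hc, hh.eq_zero_of_star_mul_self hx, map_zero]
  have hpos : ∀ x ∈ positiveCone (A ⊗[ℂ] Cop A), 0 ≤ H x := by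
    intro x hx
    induction hx using AddSubmonoid.closure_induction with
    | mem x hx => obtain ⟨y, rfl⟩ := hx; exact hH.nonneg y
    | zero => simp
    | add x y _ _ hx hy => rw [map_add]; exact add_nonneg hx hy
  have hjordan : ∀ z, E z = 0 → ∀ b c,
      H (comulTilde A b * z * comulTilde A c + comulTilde A c * z * comulTilde A b) = 0 :=
    fun z hz b c => apply_mul_mul_add_eq_zero hE1 hEpos hmul hpos hHE hfaith
      isBoundedElement_tensor hz (hEΔ b) (hEΔ c)
  -- `E` maps `y ⊗ 1` to `h(y) 1`
  have hEy : ∀ y : A, E (y ⊗ₜ[ℂ] 1 - h y • 1) = 0 := by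
    intro y
    obtain ⟨f, hf⟩ := hEmem (y ⊗ₜ[ℂ] 1)
    have hz : E (y ⊗ₜ[ℂ] 1 - comulTilde A f) = 0 := by rw [map_sub, hEΔ, hf, sub_self]
    have h1 : ∀ c, h ((f - h y • 1) * c) + h (c * (f - h y • 1)) = 0 := by
      intro c
      have h2 := hjordan _ hz 1 c
      simp only [comulTilde_one, one_mul, mul_one, sub_mul, mul_sub, ← comulTilde_mul, map_add,
        map_sub, hHΔ, hh.apply_tmul_one_mul_comulTilde hHh, hh.apply_comulTilde_mul_tmul_one hHh]
        at h2
      simp only [sub_mul, mul_sub, smul_mul_assoc, mul_smul_comm, one_mul, mul_one, map_sub,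
        map_smul, smul_eq_mul]
      linear_combination -h2
    set g := f - h y • (1 : A) with hg
    have h3 := h1 (star g)
    have h4 := hh.nonneg (star g)
    rw [star_star] at h4
    have h5 : h (star g * g) = 0 :=
      le_antisymm (by rw [eq_neg_of_add_eq_zero_right h3]; exact neg_nonpos.2 h4) (hh.nonneg g)
    have h6 := hh.eq_zero_of_star_mul_self h5
    rw [map_sub, ← hf, map_smul, hE1, ← comulTilde_one, ← map_smul, ← map_sub, ← hg, h6, map_zero]
  refine ⟨Matrix.of fun i m => ∑ k, ∑ l, h (antipodeInv A (u l m) *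
    (antipodeInv A (u i k) * a * u k l)) - leftPairing h a (u i m), fun i j c => ?_⟩
  -- sum the Jordan relation over `y = S⁻¹(b₁) a` and `b₂`, for `b = u i j`
  have hsum : ∑ k, H (comulTilde A (u k j) *
      ((antipodeInv A (u i k) * a) ⊗ₜ[ℂ] 1 - h (antipodeInv A (u i k) * a) • 1) * comulTilde A c +
      comulTilde A c * ((antipodeInv A (u i k) * a) ⊗ₜ[ℂ] 1 -
        h (antipodeInv A (u i k) * a) • 1) * comulTilde A (u k j)) = 0 :=
    Finset.sum_eq_zero fun k _ => hjordan _ (hEy _) _ _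
  have t1 : ∑ k, H (comulTilde A (u k j) * ((antipodeInv A (u i k) * a) ⊗ₜ[ℂ] 1) *
      comulTilde A c) = ∑ k, rightPairing h a (u i k) * h (u k j * c) := by
    rw [← map_sum, ← Finset.sum_mul, hu.isRep.sum_comulTilde_mul,
      hh.apply_tmul_mul_comulTilde hHh hu.isRep]
    rfl
  have t2 : ∑ k, H (comulTilde A c * ((antipodeInv A (u i k) * a) ⊗ₜ[ℂ] 1) *
      comulTilde A (u k j)) = ∑ m, (∑ k, ∑ l, h (antipodeInv A (u l m) *
        (antipodeInv A (u i k) * a * u k l))) * h (c * u m j) := by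
    have e : ∀ k, H (comulTilde A c * ((antipodeInv A (u i k) * a) ⊗ₜ[ℂ] 1) *
        comulTilde A (u k j)) = ∑ l, ∑ m, h (antipodeInv A (u l m) *
          (antipodeInv A (u i k) * a * u k l)) * h (c * u m j) := by
      intro k
      rw [hu.isRep.comulTilde_apply, Finset.mul_sum, map_sum]
      refine Finset.sum_congr rfl fun l _ => ?_
      rw [mul_assoc, Algebra.TensorProduct.tmul_mul_tmul, one_mul,
        hh.apply_comulTilde_mul_tmul hHh hu.isRep]
    simp_rw [e, Finset.sum_mul]
    symm
    rw [Finset.sum_comm]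
    exact Finset.sum_congr rfl fun k _ => Finset.sum_comm
  simp only [mul_sub, sub_mul, mul_smul_comm, smul_mul_assoc, mul_one, map_add, map_sub, map_smul,
    ← comulTilde_mul, hHΔ, smul_eq_mul, Finset.sum_add_distrib, Finset.sum_sub_distrib, t1, t2]
    at hsum
  simp only [Matrix.of_apply, sub_mul, Finset.sum_sub_distrib, leftPairing_apply]
  linear_combination hsum

end Expected

/-! ### Kac type implies expected -/

section Kac

open HopfAlgebra Coalgebra Cop

variable {A : Type u} [Ring A] [StarRing A] [HopfAlgebra ℂ A] [StarModule ℂ A] [IsCQGAlgebra A]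
  {n m : ℕ} {u : Matrix (Fin n) (Fin n) A} {v : Matrix (Fin m) (Fin m) A} {h : A →ₗ[ℂ] ℂ}

/-- The map `a ⊗ b̃ ↦ h(a S(b₁)) b₂`, adjoint to `Δ̃` for the Haar states. -/
noncomputable def expectation (h : A →ₗ[ℂ] ℂ) : A ⊗[ℂ] Cop A →ₗ[ℂ] A :=
  TensorProduct.lift <| LinearMap.mk₂ ℂ
    (fun a b => TensorProduct.lid ℂ A
      ((rightPairing h a).rTensor A (comul (R := ℂ) ((tilde A).symm b))))
    (fun a a' b => by simp [LinearMap.rTensor_add])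
    (fun c a b => by simp [LinearMap.rTensor_smul])
    (fun a b b' => by simp)
    (fun c a b => by simp)

theorem IsRep.expectation_tmul (hu : IsRep u) (a : A) (i j) :
    expectation h (a ⊗ₜ[ℂ] tilde A (u i j)) = ∑ k, h (a * antipode ℂ (u i k)) • u k j := by
  simp [expectation, hu.comul_apply]

/-- `A ⊗ Aᶜᵒᵖ` is spanned by the elements `(a ⊗ 1) Δ̃(c)`, because
`a ⊗ b̃ = (a S(b₁) ⊗ 1) Δ̃(b₂)`. -/
theorem exists_eq_sum_tmul_one_mul (x : A ⊗[ℂ] Cop A) :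
    ∃ s : Finset (A × A), x = ∑ i ∈ s, (i.1 ⊗ₜ[ℂ] 1) * comulTilde A i.2 := by
  let G : A ⊗[ℂ] A →ₗ[ℂ] A ⊗[ℂ] Cop A := TensorProduct.lift <| LinearMap.mk₂ ℂ
    (fun a c => (a ⊗ₜ[ℂ] 1) * comulTilde A c)
    (fun a a' c => by simp [TensorProduct.add_tmul, add_mul])
    (fun r a c => by simp [← TensorProduct.smul_tmul'])
    (fun a c c' => by simp [mul_add])
    (fun r a c => by simp)
  have hG : ∀ a c, G (a ⊗ₜ c) = (a ⊗ₜ[ℂ] 1) * comulTilde A c := fun a c => by simp [G]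
  have hmem : ∀ a b, a ⊗ₜ[ℂ] tilde A b ∈ LinearMap.range G := by
    intro a b
    induction b using coeff_induction with
    | coeff n u hu i j =>
      refine ⟨∑ k, (a * antipode ℂ (u i k)) ⊗ₜ u k j, ?_⟩
      simp_rw [map_sum, hG, hu.isRep.comulTilde_apply, Finset.mul_sum,
        Algebra.TensorProduct.tmul_mul_tmul, one_mul]
      rw [Finset.sum_comm]
      simp_rw [← TensorProduct.sum_tmul, mul_assoc, ← Finset.mul_sum,
        hu.isRep.sum_antipode_mul]
      simp [TensorProduct.ite_tmul]
    | zero => simp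
    | add b c hb hc => rw [map_add, TensorProduct.tmul_add]; exact add_mem hb hc
    | smul r b hb => rw [map_smul, TensorProduct.tmul_smul]; exact Submodule.smul_mem _ r hb
  have htop : x ∈ LinearMap.range G := by
    induction x with
    | zero => exact zero_mem _
    | add x y hx hy => exact add_mem hx hy
    | tmul a b => exact hmem a ((tilde A).symm b)
  obtain ⟨w, rfl⟩ := htop
  obtain ⟨s, rfl⟩ := TensorProduct.exists_finset w
  exact ⟨s, by simp [hG]⟩

theorem sum_smul_tmul_tilde (α : Fin n → ℂ) (β : Fin m → ℂ)
    (x : Fin n → A) (y : Fin m → A) :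
    ∑ p, ∑ q, (α p * β q) • (x p ⊗ₜ[ℂ] tilde A (y q)) =
      (∑ p, α p • x p) ⊗ₜ[ℂ] tilde A (∑ q, β q • y q) := by
  simp only [map_sum, map_smul, TensorProduct.sum_tmul, TensorProduct.tmul_sum]
  rw [Finset.sum_comm]
  refine Finset.sum_congr rfl fun p _ => Finset.sum_congr rfl fun q _ => ?_
  rw [TensorProduct.tmul_smul, ← TensorProduct.smul_tmul', smul_smul, mul_comm]

/-- Right `Δ̃(A)`-linearity of the adjoint of `Δ̃`, valid for any functional `h`. -/
theorem expectation_mul_comulTilde (x : A ⊗[ℂ] Cop A) (c : A) :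
    expectation h (x * comulTilde A c) = expectation h x * c := by
  induction x with
  | zero => simp
  | add x y hx hy => simp only [add_mul, map_add, hx, hy]
  | tmul a b =>
    obtain ⟨b, rfl⟩ := (tilde A).surjective b
    induction b using coeff_induction with
    | coeff m v hv k l =>
      induction c using coeff_induction with
      | coeff n u hu i j =>
        have e : ∀ p, expectation h ((a * u i p) ⊗ₜ[ℂ] tilde A (v k l * u p j)) =
            ∑ q, ∑ r, h (a * (u i p * antipode ℂ (u p r)) * antipode ℂ (v k q)) •
              (v q l * u r j) := fun p => by
          simp [expectation, Bialgebra.comul_mul, hv.comul_apply, hu.comul_apply,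
            Finset.sum_mul_sum, antipode_mul_antidistrib, mul_assoc]
        have e' : ∀ q r, ∑ p, h (a * (u i p * antipode ℂ (u p r)) * antipode ℂ (v k q)) =
            if i = r then h (a * antipode ℂ (v k q)) else 0 := fun q r => by
          rw [← map_sum, ← Finset.sum_mul, ← Finset.mul_sum, hu.isRep.sum_mul_antipode]
          split_ifs <;> simp
        rw [hu.isRep.comulTilde_apply, Finset.mul_sum, map_sum, hv.isRep.expectation_tmul,
          Finset.sum_mul]
        simp_rw [Algebra.TensorProduct.tmul_mul_tmul, ← map_mul, e]
        rw [Finset.sum_comm]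
        refine Finset.sum_congr rfl fun q _ => ?_
        rw [Finset.sum_comm]
        simp_rw [← Finset.sum_smul, e']
        simp
      | zero => simp
      | add b c hb hc => simp only [map_add, mul_add, hb, hc]
      | smul r b hb => simp only [map_smul, mul_smul_comm, hb]
    | zero => simp
    | add b c hb hc => simp only [map_add, TensorProduct.tmul_add, add_mul, hb, hc]
    | smul r b hb => simp only [map_smul, TensorProduct.tmul_smul, smul_mul_assoc, hb]

namespace IsHaarState

theorem expectation_one (hh : IsHaarState h) : expectation h 1 = (1 : A) := by
  rw [Algebra.TensorProduct.one_def]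
  simp [expectation, Algebra.TensorProduct.one_def, hh.map_one, HopfAlgebra.antipode_one]

theorem expectation_comulTilde (hh : IsHaarState h) (c : A) :
    expectation h (comulTilde A c) = c := by
  rw [← one_mul (comulTilde A c), expectation_mul_comulTilde, hh.expectation_one, one_mul]

/-- For a tracial Haar state the antipode is involutive. -/
theorem antipode_eq_antipodeInv (hh : IsHaarState h) (htr : ∀ a b, h (a * b) = h (b * a)) (a : A) :
    antipode ℂ a = antipodeInv A a := by
  induction a using coeff_induction with
  | coeff n u hu i j =>
    -- the two forms of strong invariance agree on tracial states
    have h1 : ∀ b : A, ∀ j, ∑ p, h (u p j * b) • antipode ℂ (u i p) =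
        ∑ p, h (u p j * b) • antipodeInv A (u i p) := by
      intro b j
      induction b using coeff_induction with
      | coeff m v hv k l =>
        rw [← hh.strong_right hu.isRep hv.isRep]
        simp_rw [htr (u _ j)]
        exact hh.strong_right' hu.isRep hv.isRep i j k l
      | zero => simp
      | add b c hb hc => simp only [mul_add, map_add, add_smul, Finset.sum_add_distrib, hb, hc]
      | smul r b hb => simp only [mul_smul_comm, map_smul, smul_assoc, ← Finset.smul_sum, hb]
    have h2 : ∀ f : A →ₗ[ℂ] A, ∑ q, ∑ p, h (u p q * antipode ℂ (u q j)) • f (u i p) =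
        f (u i j) := by
      intro f
      rw [Finset.sum_comm]
      simp_rw [← Finset.sum_smul, ← map_sum, hu.isRep.sum_mul_antipode]
      simp [apply_ite h, hh.map_one]
    rw [← h2, ← h2 (antipodeInv A)]
    exact Finset.sum_congr rfl fun q _ => h1 _ q
  | zero => simp
  | add a b ha hb => simp [ha, hb]
  | smul r a ha => simp [ha]

/-- Left `Δ̃(A)`-linearity on `A ⊗ 1`; this is where the trace property enters. -/
theorem expectation_comulTilde_mul (hh : IsHaarState h) (htr : ∀ a b, h (a * b) = h (b * a))
    (a c : A) : expectation h (comulTilde A c * (a ⊗ₜ[ℂ] 1)) = h a • c := by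
  induction c using coeff_induction with
  | coeff n u hu i j =>
    have h1 : ∀ k, ∑ p, h (u i p * a * antipode ℂ (u p k)) = if i = k then h a else 0 := by
      intro k
      have : ∀ p, h (u i p * a * antipode ℂ (u p k)) = h (a * (antipodeInv A (u p k) * u i p)) :=
        fun p => by rw [mul_assoc, htr, mul_assoc, hh.antipode_eq_antipodeInv htr]
      simp_rw [this, ← map_sum, ← Finset.mul_sum, hu.isRep.sum_antipodeInv_mul]
      split_ifs <;> simp
    rw [hu.isRep.comulTilde_apply, Finset.sum_mul, map_sum]
    simp_rw [Algebra.TensorProduct.tmul_mul_tmul, mul_one, hu.isRep.expectation_tmul]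
    rw [Finset.sum_comm]
    simp_rw [← Finset.sum_smul, h1]
    simp
  | zero => simp
  | add b c hb hc => simp only [map_add, add_mul, hb, hc, smul_add]
  | smul r b hb => simp only [map_smul, smul_mul_assoc, hb, smul_comm r]

open scoped MatrixOrder in
/-- The Gram matrix `h(aᵢ* aⱼ)` is of the form `B* B`, which makes `∑ h(aᵢ* aⱼ) cᵢ* cⱼ` a sum of
squares. -/
theorem sum_smul_mem_positiveCone (hh : IsHaarState h) {ι : Type*} [Fintype ι] (a c : ι → A) :
    ∑ i, ∑ j, h (star (a i) * a j) • (star (c i) * c j) ∈ positiveCone A := by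
  classical
  let G : Matrix ι ι ℂ := Matrix.of fun i j => h (star (a i) * a j)
  have hG : G.PosSemidef := by
    refine .of_dotProduct_mulVec_nonneg ?_ fun x => ?_
    · ext i j
      simp [G, Matrix.conjTranspose_apply, ← hh.map_star]
    · have h1 := hh.nonneg (∑ i, x i • a i)
      have h2 : h (star (∑ i, x i • a i) * ∑ i, x i • a i) = star x ⬝ᵥ (G.mulVec x) := by
        simp only [G, dotProduct, Matrix.mulVec, Matrix.of_apply, Finset.mul_sum, star_sum,
          Finset.sum_mul, map_sum, star_smul, smul_mul_assoc, mul_smul_comm, map_smul,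
          smul_eq_mul, Pi.star_apply]
        rw [Finset.sum_comm]
        exact Finset.sum_congr rfl fun i _ => Finset.sum_congr rfl fun j _ => by ring
      rwa [h2] at h1
  obtain ⟨B, hB⟩ := CStarAlgebra.nonneg_iff_eq_star_mul_self.mp hG.nonneg
  have hGB : ∀ i j, h (star (a i) * a j) = ∑ k, star (B k i) * B k j := by
    intro i j
    have := congrFun (congrFun hB i) j
    simpa [G, Matrix.mul_apply, Matrix.star_apply] using this
  have : ∑ i, ∑ j, h (star (a i) * a j) • (star (c i) * c j) =
      ∑ k, star (∑ i, B k i • c i) * ∑ i, B k i • c i := by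
    simp_rw [hGB, star_sum, Finset.sum_mul_sum, Finset.sum_smul, star_smul, smul_mul_smul_comm]
    symm
    rw [Finset.sum_comm]
    exact Finset.sum_congr rfl fun i _ => Finset.sum_comm
  rw [this]
  exact sum_mem fun k _ => star_mul_self_mem_positiveCone _

theorem expectation_mem_positiveCone (hh : IsHaarState h) (htr : ∀ a b, h (a * b) = h (b * a))
    {x : A ⊗[ℂ] Cop A} (hx : x ∈ positiveCone (A ⊗[ℂ] Cop A)) :
    expectation h x ∈ positiveCone A := by
  induction hx using AddSubmonoid.closure_induction with
  | mem x hx =>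
    obtain ⟨y, rfl⟩ := hx
    obtain ⟨s, rfl⟩ := exists_eq_sum_tmul_one_mul y
    have h1 : ∀ i j : A × A, expectation h (star ((i.1 ⊗ₜ[ℂ] 1) * comulTilde A i.2) *
        ((j.1 ⊗ₜ[ℂ] 1) * comulTilde A j.2)) = h (star i.1 * j.1) • (star i.2 * j.2) := by
      intro i j
      rw [star_mul, ← comulTilde_star, mul_assoc, ← mul_assoc (star _) _ (comulTilde A j.2),
        TensorProduct.star_tmul, Algebra.TensorProduct.tmul_mul_tmul, ← mul_assoc,
        expectation_mul_comulTilde, star_one, one_mul, hh.expectation_comulTilde_mul htr,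
        smul_mul_assoc]
    beta_reduce
    rw [star_sum, Finset.sum_mul_sum, map_sum]
    simp_rw [map_sum, h1]
    rw [← Finset.sum_coe_sort]
    simp_rw [← Finset.sum_coe_sort s]
    exact hh.sum_smul_mem_positiveCone (fun i : s => i.1.1) (fun i : s => i.1.2)
  | zero => simp
  | add x y _ _ hx hy => rw [map_add]; exact add_mem hx hy

theorem apply_expectation_tmul (hh : IsHaarState h) (a b : A) :
    h (expectation h (a ⊗ₜ[ℂ] tilde A b)) = h a * h b := by
  induction b using coeff_induction with
  | coeff n u hu i j =>
    have h1 := congrArg (fun x => h (a * antipode ℂ x)) (hh.sum_right hu.isRep i j)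
    simp only [map_sum, map_smul, Finset.mul_sum, mul_smul_comm, HopfAlgebra.antipode_one,
      mul_one, smul_eq_mul] at h1
    rw [hu.isRep.expectation_tmul, map_sum, mul_comm (h a), ← h1]
    exact Finset.sum_congr rfl fun k _ => by rw [map_smul, smul_eq_mul, mul_comm]
  | zero => simp
  | add b c hb hc => simp only [map_add, TensorProduct.tmul_add, mul_add, hb, hc]
  | smul r b hb => simp only [map_smul, TensorProduct.tmul_smul, hb, smul_eq_mul, mul_left_comm]

theorem comp_expectation (hh : IsHaarState h) (htr : ∀ a b, h (a * b) = h (b * a)) :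
    IsHaarState (h ∘ₗ expectation h) := by
  have hpos : ∀ x ∈ positiveCone A, 0 ≤ h x := by
    intro x hx
    induction hx using AddSubmonoid.closure_induction with
    | mem x hx => obtain ⟨y, rfl⟩ := hx; exact hh.nonneg y
    | zero => simp
    | add x y _ _ hx hy => rw [map_add]; exact add_nonneg hx hy
  have hone : (1 : A ⊗[ℂ] Cop A) = (1 : A) ⊗ₜ tilde A 1 := by
    rw [Algebra.TensorProduct.one_def, _root_.map_one]
  refine ⟨by simp [hh.expectation_one, hh.map_one], fun x => hpos _
    (hh.expectation_mem_positiveCone htr (star_mul_self_mem_positiveCone x)), fun x => ?_,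
    fun x => ?_⟩
  · induction x with
    | zero => simp
    | add x y hx hy => simp only [map_add, hx, hy, add_smul]
    | tmul a b =>
      obtain ⟨b, rfl⟩ := (tilde A).surjective b
      induction a using coeff_induction with
      | coeff n u hu i j =>
        induction b using coeff_induction with
        | coeff m v hv k l =>
          rw [hu.isRep.comul_tmul_tilde hv.isRep]
          simp only [map_sum, LinearMap.rTensor_tmul, TensorProduct.lid_tmul,
            LinearMap.comp_apply, hh.apply_expectation_tmul]
          refine (sum_smul_tmul_tilde _ _ _ _).trans ?_
          rw [hh.sum_left hu.isRep, hh.sum_right hv.isRep, map_smul, hone,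
            TensorProduct.tmul_smul, ← TensorProduct.smul_tmul', smul_smul, mul_comm]
        | zero => simp
        | add b c hb hc => simp only [map_add, TensorProduct.tmul_add, hb, hc, add_smul]
        | smul r b hb => simp only [map_smul, TensorProduct.tmul_smul, hb, smul_assoc]
      | zero => simp
      | add b c hb hc => simp only [map_add, TensorProduct.add_tmul, hb, hc, add_smul]
      | smul r b hb => simp only [map_smul, ← TensorProduct.smul_tmul', hb, smul_assoc]
  · induction x with
    | zero => simp
    | add x y hx hy => simp only [map_add, hx, hy, add_smul]
    | tmul a b =>
      obtain ⟨b, rfl⟩ := (tilde A).surjective b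
      induction a using coeff_induction with
      | coeff n u hu i j =>
        induction b using coeff_induction with
        | coeff m v hv k l =>
          rw [hu.isRep.comul_tmul_tilde hv.isRep]
          simp only [map_sum, LinearMap.lTensor_tmul, TensorProduct.rid_tmul,
            LinearMap.comp_apply, hh.apply_expectation_tmul]
          refine (sum_smul_tmul_tilde _ _ _ _).trans ?_
          rw [hh.sum_right hu.isRep, hh.sum_left hv.isRep, map_smul, hone,
            TensorProduct.tmul_smul, ← TensorProduct.smul_tmul', smul_smul, mul_comm]
        | zero => simp
        | add b c hb hc => simp only [map_add, TensorProduct.tmul_add, hb, hc, add_smul]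
        | smul r b hb => simp only [map_smul, TensorProduct.tmul_smul, hb, smul_assoc]
      | zero => simp
      | add b c hb hc => simp only [map_add, TensorProduct.add_tmul, hb, hc, add_smul]
      | smul r b hb => simp only [map_smul, ← TensorProduct.smul_tmul', hb, smul_assoc]

end IsHaarState

theorem isExpected_of_isKacType (hK : IsKacType A) :
    IsExpected (LinearMap.range (comulTilde A)) := by
  obtain ⟨h, hh, htr⟩ := hK
  refine ⟨h ∘ₗ expectation h, hh.comp_expectation htr, comulTilde A ∘ₗ expectation h,
    fun x => ⟨_, rfl⟩, ?_, ?_, fun x hx => ?_, fun x => ?_⟩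
  · rintro _ ⟨c, rfl⟩
    rw [LinearMap.comp_apply, hh.expectation_comulTilde]
  · rw [LinearMap.comp_apply, hh.expectation_one, comulTilde_one]
  · rw [LinearMap.comp_apply]
    have hy := hh.expectation_mem_positiveCone htr hx
    generalize expectation h x = y at hy
    induction hy using AddSubmonoid.closure_induction with
    | mem y hy =>
      obtain ⟨w, rfl⟩ := hy
      simp only [comulTilde_mul, comulTilde_star]
      exact star_mul_self_mem_positiveCone _
    | zero => simp
    | add x y _ _ hx hy => rw [map_add]; exact add_mem hx hy
  · rw [LinearMap.comp_apply, LinearMap.comp_apply, LinearMap.comp_apply,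
      hh.expectation_comulTilde]

end Kac

end CompactQuantumGroup

theorem mainTheorem8 {A : Type u} [Ring A] [StarRing A] [HopfAlgebra ℂ A] [StarModule ℂ A]
    [CompactQuantumGroup.IsCQGAlgebra A] :
    CompactQuantumGroup.IsExpected (LinearMap.range (CompactQuantumGroup.comulTilde A)) ↔
      CompactQuantumGroup.IsKacType A :=
  ⟨CompactQuantumGroup.isKacType_of_isExpected, CompactQuantumGroup.isExpected_of_isKacType⟩
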